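/- Let $n\in\mathbb N$, $\hbar>0$, $s\ge 0$ and $1\le q\le\infty$. Write $z=(x,p)\in\mathbb R^{2n}=\mathbb R^n\times\mathbb R^n$ and $\sigma(z,z')=p\cdot x'-p'\cdot x$. For a tempered distribution $u$ on $\mathbb R^d$ and a Schwartz function $g$ let $V_gu(y,\eta)=\int e^{-2\pi i\eta\cdot y'}u(y')\overline{g(y'-y)}\,dy'$ (a distributional pairing). * $L^q_s(\mathbb R^{2n})$ is the space of measurable $F$ with $(1+|z|^2)^{s/2}F\in L^q(\mathbb R^{2n})$. * $M^q_s(\mathbb R^n)$ is the space of $\psi\in\mathcal S'(\mathbb R^n)$ such that $V_g\psi\in L^q_s(\mathbb R^{2n})$ for some nonzero $g\in\mathcal S(\mathbb R^n)$. * $M^{\infty,1}_s(\mathbb R^{2n})$ is the space of $A\in\mathcal S'(\mathbb R^{2n})$ such that $\int_{\mathbb R^{2n}}\sup_{z}\big[|V_\Phi A(z,\zeta)|(1+|z|^2+|\zeta|^2)^{s/2}\big]d\zeta<\infty$ for some nonzero $\Phi\in\mathcal S(\mathbb R^{2n})$. * For a window $\phi\in\mathcal S(\mathbb R^n)$, $\phi\ne0$,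 and $\psi\in\mathcal S'(\mathbb R^n)$, $$W_\phi\psi(x,p)=\left(\tfrac1{2\pi\hbar}\right)^{n/2}\int_{\mathbb R^n}e^{-\frac i\hbar p\cdot y}\psi(x+\tfrac12y)\overline{\phi(x-\tfrac12y)}\,dy .$$ A function $B\in L^q_s(\mathbb R^{2n})$ is called *admissible* if $B=W_\phi\psi$ almost everywhere for some $\psi\in M^q_s(\mathbb R^n)$ and some window $\phi$. * The Moyal product is $$A\star_\hbar B(z)=\left(\tfrac1{\pi\hbar}\right)^{2n}\iint e^{-\frac{2i}\hbar\sigma(z-z',z-z'')}A(z')B(z'')\,dz'\,dz'' .$$ For $A\in\mathcal S'(\mathbb R^{2n})$ and $\Theta\in\mathcal S(\mathbb R^{2n})$ the same formula defines the function $\Theta\star_\hbar A$ pointwise (integrate first against $\Theta$, then pair with $A$). For a function $B$, the product $A\star_\hbar B$ is taken in the sense of distributions: it is the function $C$ such that, for all $\Theta\in\mathcal S(\mathbb R^{2n})$, both $B\,(\Theta\star_\hbar A)$ and $C\,\Theta$ are integrable and $\int C\,\Theta\,dz=\int B\,(\Theta\star_\hbar A)\,dz$. **Proposition.** If $A\in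 M^{\infty,1}_s(\mathbb R^{2n})$ and $B\in L^q_s(\mathbb R^{2n})$ is admissible, then $A\star_\hbar B$ exists and $A\star_\hbar B\in L^q_s(\mathbb R^{2n})$. -/

import Mathlib

open MeasureTheory Complex Function
open scoped SchwartzMap ENNReal RealInnerProductSpace FourierTransform ComplexConjugate

noncomputable section

/-! ### Auxiliary facts: characters have temperate growth -/

theorem hasTemperateGrowth_cexp_ofReal_mul_I :
    (fun t : ℝ => cexp (t * I)).HasTemperateGrowth := by
  have hderiv : ∀ m : ℕ, iteratedDeriv m (fun t : ℝ => cexp (t * I))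
      = fun t : ℝ => I ^ m * cexp (t * I) := by
    intro m
    induction m with
    | zero => simp
    | succ m ih =>
      rw [iteratedDeriv_succ, ih]
      funext t
      have h1 : HasDerivAt (fun t : ℝ => (t : ℂ) * I) (1 * I) t :=
        (Complex.ofRealCLM.hasDerivAt (x := t)).mul_const I
      have h2 := (h1.cexp).const_mul (I ^ m)
      rw [h2.deriv]
      ring
  refine ⟨?_, fun m => ⟨0, 1, fun t => ?_⟩⟩
  · exact (Complex.ofRealCLM.contDiff.mul contDiff_const).cexp
  · rw [norm_iteratedFDeriv_eq_norm_iteratedDeriv, hderiv]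
    simp [Complex.norm_exp_ofReal_mul_I]

theorem hasTemperateGrowth_character {V : Type*} [NormedAddCommGroup V] [NormedSpace ℝ V]
    {f : V → ℝ} (hf : f.HasTemperateGrowth) :
    (fun x : V => cexp ((f x : ℂ) * I)).HasTemperateGrowth :=
  hasTemperateGrowth_cexp_ofReal_mul_I.comp hf

/-- A function that coincides with a Schwartz function, as a Schwartz function. -/
def schwartzOfEq {V : Type*} [NormedAddCommGroup V] [NormedSpace ℝ V] (f : V → ℂ)
    (h : ∃ g : 𝓢(V, ℂ), ∀ x, g x = f x) : 𝓢(V, ℂ) where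
  toFun := f
  smooth' := by
    obtain ⟨g, hg⟩ := h
    have : f = g := funext fun x => (hg x).symm
    rw [this]; exact g.smooth'
  decay' := by
    obtain ⟨g, hg⟩ := h
    have : f = g := funext fun x => (hg x).symm
    rw [this]; exact g.decay'

@[simp]
theorem schwartzOfEq_apply {V : Type*} [NormedAddCommGroup V] [NormedSpace ℝ V] (f : V → ℂ)
    (h : ∃ g : 𝓢(V, ℂ), ∀ x, g x = f x) (x : V) : schwartzOfEq f h x = f x := rfl

/-- Complex conjugate of a Schwartz function. -/
def schwartzConj {V : Type*} [NormedAddCommGroup V] [NormedSpace ℝ V] (f : 𝓢(V, ℂ)) :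
    𝓢(V, ℂ) :=
  schwartzOfEq (fun x => conj (f x))
    ⟨SchwartzMap.postcompCLM (𝕜 := ℝ) Complex.conjCLE.toContinuousLinearMap f, fun _ => rfl⟩

/-! ### The short-time Fourier transform of a tempered distribution -/

/-- The function `y ↦ exp (-2π i ξ·y) * conj (Φ (y - x))`. -/
def stftWindow {V : Type*} [NormedAddCommGroup V] [InnerProductSpace ℝ V]
    (Φ : 𝓢(V, ℂ)) (x ξ : V) : 𝓢(V, ℂ) :=
  schwartzOfEq (fun y => cexp (((-(2 * Real.pi * ⟪ξ, y⟫) : ℝ) : ℂ) * I) * conj (Φ (y - x)))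
    ⟨SchwartzMap.smulLeftCLM ℂ
        (fun y : V => cexp (((-(2 * Real.pi * ⟪ξ, y⟫) : ℝ) : ℂ) * I))
        (SchwartzMap.compSubConstCLM ℂ x (schwartzConj Φ)), by
      intro y
      rw [SchwartzMap.smulLeftCLM_apply_apply]
      · rfl
      · exact hasTemperateGrowth_character (by fun_prop)⟩

/-- Short-time Fourier transform
`V_Φ A (x, ξ) = ∫ exp (-2π i ξ·y) A(y) conj (Φ (y - x)) dy` of a tempered distribution. -/
def stft {V : Type*} [NormedAddCommGroup V] [InnerProductSpace ℝ V]
    (Φ : 𝓢(V, ℂ)) (A : 𝓢'(V, ℂ)) (x ξ : V) : ℂ :=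
  A (stftWindow Φ x ξ)

/-! ### Phase space -/

/-- `ℝⁿ` with its Euclidean structure. -/
abbrev Config (n : ℕ) : Type := EuclideanSpace ℝ (Fin n)

/-- Phase space `ℝ²ⁿ = ℝⁿ × ℝⁿ` with its Euclidean structure; `z.fst` is the position `x` and
`z.snd` the momentum `p` of `z = (x, p)`. -/
abbrev PhaseSpace (n : ℕ) : Type := WithLp 2 (Config n × Config n)

/-- The standard symplectic form `σ(z, z') = p·x' - p'·x`. -/
def symplecticForm {n : ℕ} (z z' : PhaseSpace n) : ℝ :=
  ⟪z.snd, z'.fst⟫ - ⟪z'.snd, z.fst⟫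

/-! ### Weighted Lebesgue spaces and modulation spaces -/

/-- `B ∈ L_s^q(ℝ²ⁿ)`: `B` is measurable and `(1 + |z|²)^(s/2) B(z)` is in `L^q`. -/
def MemWeightedLp {n : ℕ} (s : ℝ) (q : ℝ≥0∞) (B : PhaseSpace n → ℂ) : Prop :=
  MemLp (fun z => (((1 + ‖z‖ ^ 2) ^ (s / 2) : ℝ) : ℂ) * B z) q volume

/-- `ψ ∈ M_s^q(ℝⁿ)`: the short-time Fourier transform of `ψ` with respect to some nonzero
Schwartz window is in `L_s^q(ℝ²ⁿ)`. -/
def MemModulation {n : ℕ} (s : ℝ) (q : ℝ≥0∞) (ψ : 𝓢'(Config n, ℂ)) : Prop :=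
  ∃ φ : 𝓢(Config n, ℂ), φ ≠ 0 ∧
    MemWeightedLp s q (fun z : PhaseSpace n => stft φ ψ z.fst z.snd)

/-- `A ∈ M_s^{∞,1}(ℝ²ⁿ)`: for some nonzero Schwartz window `Φ`,
`∫ sup_z |V_Φ A(z, ζ)| (1 + |z|² + |ζ|²)^(s/2) dζ < ∞`. -/
def MemSjostrand {n : ℕ} (s : ℝ) (A : 𝓢'(PhaseSpace n, ℂ)) : Prop :=
  ∃ Φ : 𝓢(PhaseSpace n, ℂ), Φ ≠ 0 ∧
    ∫⁻ ζ : PhaseSpace n, ⨆ z : PhaseSpace n,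
      ENNReal.ofReal (‖stft Φ A z ζ‖ * (1 + ‖z‖ ^ 2 + ‖ζ‖ ^ 2) ^ (s / 2)) < ∞

/-! ### The wave-packet transform and admissible functions -/

/-- The function `t ↦ 2ⁿ exp (-(2i/ħ) p·(t - x)) * conj (φ (2x - t))`, `z = (x, p)`. -/
def wavePacketWindow {n : ℕ} (ħ : ℝ) (φ : 𝓢(Config n, ℂ)) (z : PhaseSpace n) :
    𝓢(Config n, ℂ) :=
  schwartzOfEq
    (fun t => 2 ^ n * (cexp (((-(2 / ħ * ⟪z.snd, t - z.fst⟫) : ℝ) : ℂ) * I)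
      * conj (φ ((2 : ℝ) • z.fst - t))))
    ⟨(2 : ℂ) ^ n • SchwartzMap.smulLeftCLM ℂ
        (fun t : Config n => cexp (((-(2 / ħ * ⟪z.snd, t - z.fst⟫) : ℝ) : ℂ) * I))
        (SchwartzMap.compSubConstCLM ℂ ((2 : ℝ) • z.fst)
          (SchwartzMap.compCLMOfContinuousLinearEquiv ℂ (ContinuousLinearEquiv.neg ℝ)
            (schwartzConj φ))), by
      intro t
      rw [smul_apply, SchwartzMap.smulLeftCLM_apply_apply]
      · simp [schwartzConj]
      · exact hasTemperateGrowth_character (by fun_prop)⟩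

/-- Windowed wave-packet transform
`W_φ ψ(x, p) = (2πħ)^(-n/2) ∫ exp (-(i/ħ) p·y) ψ(x + y/2) conj (φ(x - y/2)) dy`
of a tempered distribution `ψ`. The integral is the pairing of `ψ` with a Schwartz function,
after the substitution `t = x + y/2`. -/
def wavePacket {n : ℕ} (ħ : ℝ) (φ : 𝓢(Config n, ℂ)) (ψ : 𝓢'(Config n, ℂ))
    (z : PhaseSpace n) : ℂ :=
  (((1 / (2 * Real.pi * ħ)) ^ ((n : ℝ) / 2) : ℝ) : ℂ) * ψ (wavePacketWindow ħ φ z)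

/-- `B ∈ L_s^q(ℝ²ⁿ)` is admissible: `B = W_φ ψ` (almost everywhere) for some `ψ ∈ M_s^q(ℝⁿ)` and
some window `φ`, a nonzero Schwartz function. Rescaling `φ` and `ψ`, one may take `φ` to have
`L²` norm one. -/
def IsAdmissible {n : ℕ} (ħ s : ℝ) (q : ℝ≥0∞) (B : PhaseSpace n → ℂ) : Prop :=
  MemWeightedLp s q B ∧
    ∃ ψ : 𝓢'(Config n, ℂ), MemModulation s q ψ ∧
      ∃ φ : 𝓢(Config n, ℂ), φ ≠ 0 ∧ B =ᵐ[volume] wavePacket ħ φ ψ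

/-! ### The Moyal product -/

/-- The linear map `w ↦ (-w_p, w_x) / (πħ)`, so that `2π ⟪z, w'⟫ = (2/ħ) σ(z, w)` for the
image `w'` of `w`. -/
def rotEquiv (n : ℕ) {ħ : ℝ} (hħ : 0 < ħ) : PhaseSpace n ≃L[ℝ] PhaseSpace n :=
  (WithLp.prodContinuousLinearEquiv 2 ℝ (Config n) (Config n)).trans
    (((ContinuousLinearEquiv.prodComm ℝ (Config n) (Config n)).trans
      ((ContinuousLinearEquiv.smulLeft (Units.mk0 (-(Real.pi * ħ)⁻¹)
          (neg_ne_zero.mpr (inv_ne_zero (mul_pos Real.pi_pos hħ).ne')))).prodCongr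
        (ContinuousLinearEquiv.smulLeft (Units.mk0 (Real.pi * ħ)⁻¹
          (inv_ne_zero (mul_pos Real.pi_pos hħ).ne'))))).trans
      (WithLp.prodContinuousLinearEquiv 2 ℝ (Config n) (Config n)).symm)

theorem rotEquiv_apply (n : ℕ) {ħ : ℝ} (hħ : 0 < ħ) (w : PhaseSpace n) :
    rotEquiv n hħ w
      = WithLp.toLp 2 (-(Real.pi * ħ)⁻¹ • w.snd, (Real.pi * ħ)⁻¹ • w.fst) := rfl

/-- The function `z' ↦ ∫ exp (-(2i/ħ) σ(z - z', z - z'')) Θ(z) dz`, which is a Schwartz function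
of `z'` for every Schwartz function `Θ`. -/
def moyalTest {n : ℕ} {ħ : ℝ} (hħ : 0 < ħ) (Θ : 𝓢(PhaseSpace n, ℂ)) (z'' : PhaseSpace n) :
    𝓢(PhaseSpace n, ℂ) :=
  schwartzOfEq
    (fun z' => ∫ z : PhaseSpace n,
      cexp (((-(2 / ħ * symplecticForm (z - z') (z - z'')) : ℝ) : ℂ) * I) * Θ z)
    ⟨SchwartzMap.smulLeftCLM ℂ
        (fun z' : PhaseSpace n =>
          cexp (((-(2 / ħ * (⟪z'.snd, z''.fst⟫ - ⟪z''.snd, z'.fst⟫)) : ℝ) : ℂ) * I))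
        (SchwartzMap.compSubConstCLM ℂ z''
          (SchwartzMap.compCLMOfContinuousLinearEquiv ℂ (rotEquiv n hħ) (𝓕 Θ))), by
      intro z'
      rw [SchwartzMap.smulLeftCLM_apply_apply]
      · simp only [SchwartzMap.compSubConstCLM_apply, smul_eq_mul,
          SchwartzMap.compCLMOfContinuousLinearEquiv_apply, Function.comp_apply]
        rw [SchwartzMap.fourier_coe, Real.fourier_eq', ← integral_const_mul]
        congr 1
        funext z
        rw [smul_eq_mul, ← mul_assoc, ← Complex.exp_add]
        congr 2
        rw [← add_mul, ← Complex.ofReal_add]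
        congr 2
        have h1 : ħ ≠ 0 := hħ.ne'
        have h2 := Real.pi_ne_zero
        simp only [symplecticForm, rotEquiv_apply, WithLp.prod_inner_apply, inner_smul_right,
          WithLp.sub_fst, WithLp.sub_snd,
          inner_sub_left, inner_sub_right]
        change _ + -2 * Real.pi *
          (-(Real.pi * ħ)⁻¹ * (⟪z.fst, z'.snd⟫ - ⟪z.fst, z''.snd⟫) +
            (Real.pi * ħ)⁻¹ * (⟪z.snd, z'.fst⟫ - ⟪z.snd, z''.fst⟫)) = _
        rw [real_inner_comm z'.snd z.fst, real_inner_comm z''.snd z.fst]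
        field_simp
        ring
      · apply hasTemperateGrowth_character
        have e1 : (fun z' : PhaseSpace n => z'.fst).HasTemperateGrowth :=
          (WithLp.fstL 2 ℝ (Config n) (Config n)).hasTemperateGrowth
        have e2 : (fun z' : PhaseSpace n => z'.snd).HasTemperateGrowth :=
          (WithLp.sndL 2 ℝ (Config n) (Config n)).hasTemperateGrowth
        fun_prop⟩

/-- The function `Θ ⋆_ħ A` for a Schwartz function `Θ` and a tempered distribution `A`:
`(Θ ⋆_ħ A)(z'') = (πħ)^(-2n) ∬ exp (-(2i/ħ) σ(z'' - z, z'' - z')) Θ(z) A(z') dz dz'`,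
where the integral over `z'` is the pairing with the distribution `A`. The phase is written in
the form `σ(z'' - z, z'' - z') = σ(z - z', z - z'')`. -/
def schwartzMoyal {n : ℕ} {ħ : ℝ} (hħ : 0 < ħ) (Θ : 𝓢(PhaseSpace n, ℂ))
    (A : 𝓢'(PhaseSpace n, ℂ)) (z'' : PhaseSpace n) : ℂ :=
  (((1 / (Real.pi * ħ)) ^ (2 * n) : ℝ) : ℂ) * A (moyalTest hħ Θ z'')

/-- The function `C` is the Moyal product `A ⋆_ħ B` of a tempered distribution `A` and a
function `B`. The defining integral
`(A ⋆_ħ B)(z) = (πħ)^(-2n) ∬ exp (-(2i/ħ) σ(z - z', z - z'')) A(z') B(z'') dz' dz''`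
is oscillatory and is taken in the sense of tempered distributions: it is tested against
Schwartz functions `Θ`, and integrated with respect to `z`, then `z'`, then `z''`. In other words
`∫ (A ⋆_ħ B) Θ = ∫ B (Θ ⋆_ħ A)` for every Schwartz function `Θ`. -/
structure IsMoyalProduct {n : ℕ} {ħ : ℝ} (hħ : 0 < ħ) (A : 𝓢'(PhaseSpace n, ℂ))
    (B C : PhaseSpace n → ℂ) : Prop where
  integrable_pairing : ∀ Θ : 𝓢(PhaseSpace n, ℂ),
    Integrable (fun z'' => B z'' * schwartzMoyal hħ Θ A z'') volume
  integrable_test : ∀ Θ : 𝓢(PhaseSpace n, ℂ), Integrable (fun z => C z * Θ z) volume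
  integral_eq : ∀ Θ : 𝓢(PhaseSpace n, ℂ),
    ∫ z, C z * Θ z = ∫ z'', B z'' * schwartzMoyal hħ Θ A z''

end

/-! A wave-packet transform is, up to a phase and a linear scaling of phase space, a short-time
Fourier transform. The inversion formula for the latter (`stft_inversion`) therefore makes `b = W_φ
ψ` reproduce itself under a twisted convolution, `b(z) = ∫ b(z') χ(z, z') κ(z - z') dz'`, with `χ(z,
z') = exp(-(2i/ħ) σ(z, z'))` and `κ` a multiple of the ambiguity function of `φ`
(`exists_reproducing`). It thus suffices to multiply `A` by the elementary functions `k_{z'}(z) =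
χ(z, z') κ(z - z')` and to superpose the results with coefficients `b(z')`.

The Moyal phase is affine in each variable. Hence `(A ⋆ k_{z'})(w)` is, up to a constant and a
phase, the value of a short-time Fourier transform of `A` at position `w + z'` and frequency `J(z' -
w)`, where `J` is `rotEquiv` (`stftWindow_moyalWindow_apply`). Membership of `A` in the Sjöstrand
class bounds this by `h(J(z' - w))`, with `h` integrable against the weight, whatever the window
(`exists_bound_stft_of_window`). The map `b ↦ A ⋆ b` is thus dominated by convolution with a
weighted integrable function. Since the weight is submultiplicative up to a constant, Young's
inequality gives the `L^q_s` bound for every `q ≥ 1`.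

It remains to identify this superposition with the distributional product. The function `Θ ⋆ A` is a
short-time Fourier transform of `A` restricted to the graph of `J` (`moyalTest_eq_stftWindow`),
hence integrable, while `b` is bounded, by Hölder's inequality in the reproducing formula. All
double integrals then converge absolutely, and Fubini together with `integral_twisted_mul_moyalTest`
gives the identity. Applying `A` under an integral sign rests on `exists_integral_smul`, a theory of
integrals of Schwartz-valued families. -/

set_option linter.unusedSectionVars false

/-! ### Integrals of families of Schwartz functions -/

namespace SchwartzMap

section IntegrableFamily

variable {X : Type*} [TopologicalSpace X] [SecondCountableTopology X] [MeasurableSpace X]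
  [BorelSpace X] {μ : Measure X}
variable {V : Type*} [NormedAddCommGroup V] [NormedSpace ℝ V]
variable {H : Type*} [NormedAddCommGroup H] [NormedSpace ℝ H]
variable {W : Type*} [NormedAddCommGroup W] [NormedSpace ℝ W]
variable {K : Type*} [NormedAddCommGroup K] [NormedSpace ℝ K]

/-- A continuous family of Schwartz functions all of whose seminorms are integrable. -/
structure IntegrableFamily (f : X → 𝓢(V, H)) (μ : Measure X) : Prop where
  continuous : Continuous f
  integrable : ∀ k l : ℕ, Integrable (fun x => SchwartzMap.seminorm ℝ k l (f x)) μ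

theorem seminorm_sup_le_sum (s : Finset (ℕ × ℕ)) (f : 𝓢(V, H)) :
    (s.sup (schwartzSeminormFamily ℝ V H)) f
      ≤ ∑ i ∈ s, SchwartzMap.seminorm ℝ i.1 i.2 f := by
  refine Seminorm.finset_sup_apply_le (Finset.sum_nonneg fun i _ => apply_nonneg _ _) ?_
  intro i hi
  exact Finset.single_le_sum (f := fun i : ℕ × ℕ => SchwartzMap.seminorm ℝ i.1 i.2 f)
    (fun i _ => apply_nonneg _ _) hi

/-- A continuous seminorm is controlled by finitely many Schwartz seminorms. A sum replaces their
supremum because integrability and polynomial growth pass directly to finite sums. -/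
theorem exists_seminorm_comp_le_sum (T : 𝓢(V, H) →L[ℝ] 𝓢(W, K)) (k l : ℕ) :
    ∃ (s : Finset (ℕ × ℕ)) (C : ℝ), 0 ≤ C ∧ ∀ f, SchwartzMap.seminorm ℝ k l (T f)
      ≤ C * ∑ i ∈ s, SchwartzMap.seminorm ℝ i.1 i.2 f := by
  have hc : Continuous ((SchwartzMap.seminorm ℝ k l).comp (T : 𝓢(V, H) →ₗ[ℝ] 𝓢(W, K))) :=
    ((schwartz_withSeminorms ℝ W K).continuous_seminorm (k, l)).comp T.continuous
  obtain ⟨s, C, -, h⟩ := Seminorm.bound_of_continuous (schwartz_withSeminorms ℝ V H) _ hc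
  refine ⟨s, C, C.2, fun f => (h f).trans ?_⟩
  exact mul_le_mul_of_nonneg_left (seminorm_sup_le_sum s f) C.2

theorem exists_norm_le_sum {E : Type*} [NormedAddCommGroup E] [NormedSpace ℝ E]
    (T : 𝓢(V, H) →L[ℝ] E) :
    ∃ (s : Finset (ℕ × ℕ)) (C : ℝ), 0 ≤ C ∧ ∀ f, ‖T f‖
      ≤ C * ∑ i ∈ s, SchwartzMap.seminorm ℝ i.1 i.2 f := by
  have hc : Continuous ((normSeminorm ℝ E).comp (T : 𝓢(V, H) →ₗ[ℝ] E)) :=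
    continuous_norm.comp T.continuous
  obtain ⟨s, C, -, h⟩ := Seminorm.bound_of_continuous (schwartz_withSeminorms ℝ V H) _ hc
  refine ⟨s, C, C.2, fun f => (h f).trans ?_⟩
  exact mul_le_mul_of_nonneg_left (seminorm_sup_le_sum s f) C.2

theorem IntegrableFamily.comp {f : X → 𝓢(V, H)} (hf : IntegrableFamily f μ)
    (T : 𝓢(V, H) →L[ℝ] 𝓢(W, K)) : IntegrableFamily (fun x => T (f x)) μ := by
  refine ⟨T.continuous.comp hf.continuous, fun k l => ?_⟩
  obtain ⟨s, C, hC, h⟩ := exists_seminorm_comp_le_sum T k l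
  refine Integrable.mono' ((integrable_finsetSum s fun i _ => hf.integrable i.1 i.2).const_mul C)
    ?_ (Filter.Eventually.of_forall fun x => ?_)
  · exact (((schwartz_withSeminorms ℝ W K).continuous_seminorm (k, l)).comp
      (T.continuous.comp hf.continuous)).aestronglyMeasurable
  · rw [Real.norm_of_nonneg (apply_nonneg _ _)]
    exact h (f x)

theorem IntegrableFamily.integrable_clm {E : Type*} [NormedAddCommGroup E] [NormedSpace ℝ E]
    {f : X → 𝓢(V, H)} (hf : IntegrableFamily f μ) (T : 𝓢(V, H) →L[ℝ] E) :
    Integrable (fun x => T (f x)) μ := by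
  obtain ⟨s, C, hC, h⟩ := exists_norm_le_sum T
  refine Integrable.mono' ((integrable_finsetSum s fun i _ => hf.integrable i.1 i.2).const_mul C)
    (T.continuous.comp hf.continuous).aestronglyMeasurable
    (Filter.Eventually.of_forall fun x => h (f x))

/-- Evaluation of a Schwartz function at a point. -/
noncomputable def evalAtCLM (y : V) : 𝓢(V, H) →L[ℝ] H :=
  (BoundedContinuousFunction.evalCLM ℝ y).comp (toBoundedContinuousFunctionCLM ℝ V H)

theorem IntegrableFamily.integrable_apply {f : X → 𝓢(V, H)} (hf : IntegrableFamily f μ) (y : V) :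
    Integrable (fun x => f x y) μ :=
  hf.integrable_clm (evalAtCLM y)

/-- The sup norm of the derivative of `f x` is an integrable majorant valid for all `y` at once, so
dominated differentiation applies on the whole space. -/
theorem IntegrableFamily.hasFDerivAt [FiniteDimensional ℝ V] {f : X → 𝓢(V, H)}
    (hf : IntegrableFamily f μ) (y : V) :
    HasFDerivAt (fun y => ∫ x, f x y ∂μ) (∫ x, fderivCLM ℝ V H (f x) y ∂μ) y := by
  have h' := hf.comp (fderivCLM ℝ V H)
  refine hasFDerivAt_integral_of_dominated_of_fderiv_le (F := fun y x => f x y)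
    (F' := fun y x => fderivCLM ℝ V H (f x) y)
    (bound := fun x => SchwartzMap.seminorm ℝ 0 0 (fderivCLM ℝ V H (f x)))
    (s := Set.univ) Filter.univ_mem ?_ (hf.integrable_apply y)
    (h'.integrable_apply y).aestronglyMeasurable ?_ (h'.integrable 0 0) ?_
  · exact Filter.Eventually.of_forall fun y => (hf.integrable_apply y).aestronglyMeasurable
  · exact Filter.Eventually.of_forall fun x y _ => norm_le_seminorm ℝ _ y
  · exact Filter.Eventually.of_forall fun x y _ => (f x).hasFDerivAt y

/-- The iterated derivative of a Schwartz function as a Schwartz function. -/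
noncomputable def iteratedFDerivCLM (V H : Type*) [NormedAddCommGroup V] [NormedSpace ℝ V]
    [NormedAddCommGroup H] [NormedSpace ℝ H] : (l : ℕ) → 𝓢(V, H) →L[ℝ] 𝓢(V, V [×l]→L[ℝ] H)
  | 0 => postcompCLM
      ((continuousMultilinearCurryFin0 ℝ V H).symm.toContinuousLinearEquiv.toContinuousLinearMap)
  | l + 1 => (postcompCLM ((continuousMultilinearCurryLeftEquiv ℝ (fun _ : Fin (l + 1) => V)
      H).symm.toContinuousLinearEquiv.toContinuousLinearMap)).comp
        ((fderivCLM ℝ V (V [×l]→L[ℝ] H)).comp (iteratedFDerivCLM V H l))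

theorem coe_iteratedFDerivCLM (l : ℕ) (f : 𝓢(V, H)) :
    ⇑(iteratedFDerivCLM V H l f) = iteratedFDeriv ℝ l f := by
  induction l with
  | zero => rfl
  | succ l ih =>
    rw [iteratedFDeriv_succ_eq_comp_left, ← ih]
    rfl

/-- The derivatives of the family again form an integrable family, so each induction step is one
more differentiation under the integral; the currying isometry commutes with the integral. -/
theorem IntegrableFamily.iteratedFDeriv_integral [FiniteDimensional ℝ V] {f : X → 𝓢(V, H)}
    (hf : IntegrableFamily f μ) (l : ℕ) :
    iteratedFDeriv ℝ l (fun y => ∫ x, f x y ∂μ)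
      = fun y => ∫ x, iteratedFDerivCLM V H l (f x) y ∂μ := by
  induction l with
  | zero =>
    rw [iteratedFDeriv_zero_eq_comp]
    funext y
    exact ((continuousMultilinearCurryFin0 ℝ V H).symm.toContinuousLinearEquiv.integral_comp_comm _).symm
  | succ l ih =>
    rw [iteratedFDeriv_succ_eq_comp_left, ih]
    funext y
    rw [Function.comp_apply, ((hf.comp (iteratedFDerivCLM V H l)).hasFDerivAt y).fderiv]
    let e : (V →L[ℝ] V [×l]→L[ℝ] H) ≃L[ℝ] (V [×(l + 1)]→L[ℝ] H) :=
      (continuousMultilinearCurryLeftEquiv ℝ (fun _ : Fin (l + 1) => V)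
        H).symm.toContinuousLinearEquiv
    exact (ContinuousLinearEquiv.integral_comp_comm (𝕜 := ℝ) (E := V →L[ℝ] V [×l]→L[ℝ] H)
      (F := V [×(l + 1)]→L[ℝ] H) (μ := μ) e
      fun x => fderivCLM ℝ V _ (iteratedFDerivCLM V H l (f x)) y).symm

/-- The integral of an integrable family of Schwartz functions. -/
noncomputable def IntegrableFamily.integral [FiniteDimensional ℝ V] {f : X → 𝓢(V, H)}
    (hf : IntegrableFamily f μ) : 𝓢(V, H) where
  toFun y := ∫ x, f x y ∂μ
  smooth' := by
    refine contDiff_of_differentiable_iteratedFDeriv fun m _ => ?_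
    rw [hf.iteratedFDeriv_integral]
    exact fun y => ((hf.comp (iteratedFDerivCLM V H m)).hasFDerivAt y).differentiableAt
  decay' k l := by
    refine ⟨∫ x, SchwartzMap.seminorm ℝ k l (f x) ∂μ, fun y => ?_⟩
    rw [hf.iteratedFDeriv_integral]
    have : ‖y‖ ^ k * ‖∫ x, iteratedFDerivCLM V H l (f x) y ∂μ‖
        = ‖∫ x, ‖y‖ ^ k • iteratedFDerivCLM V H l (f x) y ∂μ‖ := by
      rw [integral_smul, norm_smul, norm_pow, norm_norm]
    refine this.trans_le (norm_integral_le_of_norm_le (hf.integrable k l)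
      (Filter.Eventually.of_forall fun x => ?_))
    rw [norm_smul, norm_pow, norm_norm, coe_iteratedFDerivCLM]
    exact le_seminorm ℝ k l (f x) y

theorem IntegrableFamily.integral_apply [FiniteDimensional ℝ V] {f : X → 𝓢(V, H)}
    (hf : IntegrableFamily f μ) (y : V) : hf.integral y = ∫ x, f x y ∂μ := rfl

/-! ### Factoring functionals on Schwartz space through a Banach space. -/

theorem hasTemperateGrowth_one_add_norm_sq_pow {V : Type*} [NormedAddCommGroup V]
    [InnerProductSpace ℝ V] (N : ℕ) :
    (fun y : V => (1 + ‖y‖ ^ 2) ^ N).HasTemperateGrowth := by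
  fun_prop

/-- Tuples of bounded continuous functions that are candidates for weighted derivatives. -/
def DerivSpace (V H : Type*) [NormedAddCommGroup V] [NormedSpace ℝ V]
    [NormedAddCommGroup H] [NormedSpace ℝ H] (N : ℕ) : Type _ :=
  (l : Fin (N + 1)) → BoundedContinuousFunction V (V [×(l : ℕ)]→L[ℝ] H)

noncomputable instance (N : ℕ) : NormedAddCommGroup (DerivSpace V H N) :=
  inferInstanceAs (NormedAddCommGroup
    ((l : Fin (N + 1)) → BoundedContinuousFunction V (V [×(l : ℕ)]→L[ℝ] H)))

noncomputable instance (N : ℕ) : NormedSpace ℝ (DerivSpace V H N) :=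
  inferInstanceAs (NormedSpace ℝ
    ((l : Fin (N + 1)) → BoundedContinuousFunction V (V [×(l : ℕ)]→L[ℝ] H)))

instance [CompleteSpace H] (N : ℕ) : CompleteSpace (DerivSpace V H N) :=
  inferInstanceAs (CompleteSpace
    ((l : Fin (N + 1)) → BoundedContinuousFunction V (V [×(l : ℕ)]→L[ℝ] H)))

/-- Evaluation of a component of a tuple at a point. -/
noncomputable def DerivSpace.evalCLM {N : ℕ} (l : Fin (N + 1)) (y : V) :
    DerivSpace V H N →L[ℝ] (V [×(l : ℕ)]→L[ℝ] H) :=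
  (BoundedContinuousFunction.evalCLM ℝ y).comp
      (ContinuousLinearMap.proj (R := ℝ) (φ := fun l : Fin (N + 1) =>
        BoundedContinuousFunction V (V [×(l : ℕ)]→L[ℝ] H)) l)

/-- The weighted derivatives of a Schwartz function, as bounded continuous functions. -/
noncomputable def weightedDerivCLM (V H : Type*) [NormedAddCommGroup V] [InnerProductSpace ℝ V]
    [NormedAddCommGroup H] [NormedSpace ℝ H] (N : ℕ) :
    𝓢(V, H) →L[ℝ] DerivSpace V H N :=
  ContinuousLinearMap.pi (φ := fun l : Fin (N + 1) =>
      BoundedContinuousFunction V (V [×(l : ℕ)]→L[ℝ] H)) fun l => (toBoundedContinuousFunctionCLM ℝ V (V [×(l : ℕ)]→L[ℝ] H)).comp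
    ((smulLeftCLM (V [×(l : ℕ)]→L[ℝ] H) (fun y : V => (1 + ‖y‖ ^ 2) ^ N)).comp
      (iteratedFDerivCLM V H l))

theorem weightedDerivCLM_apply {V : Type*} [NormedAddCommGroup V] [InnerProductSpace ℝ V] {N : ℕ}
    (f : 𝓢(V, H)) (l : Fin (N + 1)) (y : V) :
    weightedDerivCLM V H N f l y = (1 + ‖y‖ ^ 2) ^ N • iteratedFDeriv ℝ l f y := by
  change smulLeftCLM (V [×(l : ℕ)]→L[ℝ] H) (fun y : V => (1 + ‖y‖ ^ 2) ^ N)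
    (iteratedFDerivCLM V H l f) y = _
  rw [smulLeftCLM_apply_apply (hasTemperateGrowth_one_add_norm_sq_pow N), coe_iteratedFDerivCLM]

theorem seminorm_le_norm_weightedDerivCLM {V : Type*} [NormedAddCommGroup V]
    [InnerProductSpace ℝ V] {N k l : ℕ} (hk : k ≤ N) (hl : l ≤ N) (f : 𝓢(V, H)) :
    SchwartzMap.seminorm ℝ k l f ≤ ‖weightedDerivCLM V H N f‖ := by
  refine seminorm_le_bound ℝ k l f (norm_nonneg _) fun y => ?_
  have h1 := norm_le_pi_norm (weightedDerivCLM V H N f) ⟨l, Nat.lt_succ_of_le hl⟩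
  have h2 := (weightedDerivCLM V H N f ⟨l, Nat.lt_succ_of_le hl⟩).norm_coe_le_norm y
  refine le_trans ?_ (h2.trans h1)
  rw [weightedDerivCLM_apply, norm_smul, Real.norm_of_nonneg (by positivity)]
  refine mul_le_mul_of_nonneg_right ?_ (norm_nonneg _)
  have h3 : ‖y‖ ≤ 1 + ‖y‖ ^ 2 := by nlinarith [sq_nonneg (‖y‖ - 1), sq_nonneg ‖y‖]
  calc ‖y‖ ^ k ≤ (1 + ‖y‖ ^ 2) ^ k := by gcongr
    _ ≤ (1 + ‖y‖ ^ 2) ^ N := pow_le_pow_right₀ (by nlinarith [sq_nonneg ‖y‖]) hk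

/-- A continuous functional on Schwartz space factors through a Banach space of weighted
derivatives. -/
theorem exists_eq_comp_weightedDerivCLM {V : Type*} [NormedAddCommGroup V]
    [InnerProductSpace ℝ V] (u : 𝓢(V, H) →L[ℝ] ℂ) :
    ∃ (N : ℕ) (L : DerivSpace V H N →L[ℝ] ℂ), ∀ f, u f = L (weightedDerivCLM V H N f) := by
  obtain ⟨s, C, hC, hu⟩ := exists_norm_le_sum u
  -- One `N` bounds both the polynomial weights and the orders of differentiation in all seminorms
  -- that control `u`.
  let N := s.sup fun i => max i.1 i.2
  have hN : ∀ i ∈ s, i.1 ≤ N ∧ i.2 ≤ N := fun i hi => by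
    have := Finset.le_sup (f := fun i : ℕ × ℕ => max i.1 i.2) hi
    exact ⟨(le_max_left _ _).trans this, (le_max_right _ _).trans this⟩
  have hu' : ∀ f, ‖u f‖ ≤ (C * s.card) * ‖weightedDerivCLM V H N f‖ := fun f => by
    refine (hu f).trans ?_
    rw [mul_assoc]
    refine mul_le_mul_of_nonneg_left ?_ hC
    rw [← nsmul_eq_mul]
    exact Finset.sum_le_card_nsmul _ _ _ fun i hi =>
      seminorm_le_norm_weightedDerivCLM (hN i hi).1 (hN i hi).2 f
  have hinj : Injective (weightedDerivCLM V H N).toLinearMap := by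
    rw [injective_iff_map_eq_zero]
    intro f hf
    ext y
    have := seminorm_le_norm_weightedDerivCLM (Nat.zero_le N) (Nat.zero_le N) f
    have h0 : weightedDerivCLM V H N f = 0 := hf
    rw [h0, norm_zero (E := DerivSpace V H N)] at this
    simpa using (norm_le_seminorm ℝ f y).trans this
  -- Injectivity and the bound `hu'` turn `u` into a bounded functional on the range of the
  -- embedding. Hahn–Banach extends it, since its values lie in `ℂ`, which is finite-dimensional
  -- over `ℝ`.
  let e := LinearEquiv.ofInjective _ hinj
  let L₀ : LinearMap.range (weightedDerivCLM V H N).toLinearMap →L[ℝ] ℂ :=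
    (u.toLinearMap.comp e.symm.toLinearMap).mkContinuous (C * s.card) fun w => by
      have := hu' (e.symm w)
      have hw : weightedDerivCLM V H N (e.symm w) = w := by
        have := e.apply_symm_apply w
        exact congrArg Subtype.val this
      rw [hw] at this
      exact this
  obtain ⟨L, hL⟩ := L₀.exist_extension_of_finiteDimensional_range
  refine ⟨N, L, fun f => ?_⟩
  have := DFunLike.congr_fun hL (e f)
  rw [ContinuousLinearMap.comp_apply] at this
  have h2 : L₀ (e f) = u f := by
    change u (e.symm (e f)) = u f
    rw [e.symm_apply_apply]
  rw [← h2, this]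
  rfl

/-- Continuous functionals commute with integrals of families of Schwartz functions. -/
theorem IntegrableFamily.clm_integral {V : Type*} [NormedAddCommGroup V]
    [InnerProductSpace ℝ V] [FiniteDimensional ℝ V] {f : X → 𝓢(V, H)}
    [CompleteSpace H]
    (hf : IntegrableFamily f μ) (u : 𝓢(V, H) →L[ℝ] ℂ) :
    u hf.integral = ∫ x, u (f x) ∂μ := by
  -- In the Banach space `DerivSpace V H N` the integral is a Bochner integral, with which `L`
  -- commutes. What remains is an identity of elements of that space, checked by component and by
  -- point.
  obtain ⟨N, L, hL⟩ := exists_eq_comp_weightedDerivCLM u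
  have hi := hf.integrable_clm (weightedDerivCLM V H N)
  simp only [hL]
  rw [L.integral_comp_comm hi]
  congr 1
  funext l
  ext1 y
  have h1 := ((DerivSpace.evalCLM l y).integral_comp_comm hi).symm
  change weightedDerivCLM V H N hf.integral l y = DerivSpace.evalCLM l y _
  rw [h1]
  change _ = ∫ x, weightedDerivCLM V H N (f x) l y ∂μ
  simp only [weightedDerivCLM_apply]
  rw [integral_smul]
  congr 1
  change iteratedFDeriv ℝ l (fun y => ∫ x, f x y ∂μ) y = _
  rw [hf.iteratedFDeriv_integral]
  simp only [coe_iteratedFDerivCLM]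

end IntegrableFamily

end SchwartzMap

/-! ### Polynomially bounded functions -/

/-- A real function bounded above by a polynomial in the norm. -/
def PolyBounded {X : Type*} [Norm X] (f : X → ℝ) : Prop :=
  ∃ (C : ℝ) (N : ℕ), 0 ≤ C ∧ ∀ x, f x ≤ C * (1 + ‖x‖) ^ N

namespace PolyBounded

variable {X Y : Type*} [NormedAddCommGroup X] [NormedAddCommGroup Y] {f g : X → ℝ}

theorem mono (hf : PolyBounded f) (h : ∀ x, g x ≤ f x) : PolyBounded g := by
  obtain ⟨C, N, hC, hf⟩ := hf
  exact ⟨C, N, hC, fun x => (h x).trans (hf x)⟩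

theorem const (c : ℝ) : PolyBounded (fun _ : X => c) :=
  ⟨|c|, 0, abs_nonneg c, fun x => by simpa using le_abs_self c⟩

theorem norm : PolyBounded (fun x : X => ‖x‖) :=
  ⟨1, 1, zero_le_one, fun x => by simp⟩

theorem add (hf : PolyBounded f) (hg : PolyBounded g) : PolyBounded (fun x => f x + g x) := by
  obtain ⟨C, N, hC, hf⟩ := hf
  obtain ⟨D, M, hD, hg⟩ := hg
  refine ⟨C + D, N + M, by positivity, fun x => ?_⟩
  have h1 : (1 : ℝ) ≤ 1 + ‖x‖ := by linarith [norm_nonneg x]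
  calc f x + g x ≤ C * (1 + ‖x‖) ^ N + D * (1 + ‖x‖) ^ M := add_le_add (hf x) (hg x)
    _ ≤ C * (1 + ‖x‖) ^ (N + M) + D * (1 + ‖x‖) ^ (N + M) := by
        gcongr <;> first | exact h1 | omega
    _ = _ := by ring

theorem mul (hf : PolyBounded f) (hg : PolyBounded g) (h0 : ∀ x, 0 ≤ g x) :
    PolyBounded (fun x => f x * g x) := by
  obtain ⟨C, N, hC, hf⟩ := hf
  obtain ⟨D, M, hD, hg⟩ := hg
  refine ⟨C * D, N + M, by positivity, fun x => ?_⟩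
  calc f x * g x ≤ (C * (1 + ‖x‖) ^ N) * (D * (1 + ‖x‖) ^ M) :=
        mul_le_mul (hf x) (hg x) (h0 x) (by positivity)
    _ = _ := by ring

theorem pow (hf : PolyBounded f) (h0 : ∀ x, 0 ≤ f x) (k : ℕ) :
    PolyBounded (fun x => f x ^ k) := by
  induction k with
  | zero => simpa using const (X := X) 1
  | succ k ih => simpa only [pow_succ] using ih.mul hf h0

theorem sum {ι : Type*} {s : Finset ι} {f : ι → X → ℝ} (hf : ∀ i ∈ s, PolyBounded (f i)) :
    PolyBounded (fun x => ∑ i ∈ s, f i x) := by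
  classical
  induction s using Finset.induction_on with
  | empty => simpa using const (X := X) 0
  | insert i s hi ih =>
    simp only [Finset.sum_insert hi]
    exact (hf i (Finset.mem_insert_self i s)).add
      (ih fun j hj => hf j (Finset.mem_insert_of_mem hj))

theorem comp {h : Y → ℝ} (hh : PolyBounded h) {m : X → Y} (hm : PolyBounded fun x => ‖m x‖) :
    PolyBounded (fun x => h (m x)) := by
  obtain ⟨C, N, hC, hh⟩ := hh
  exact ((const C).mul (((const 1).add hm).pow (fun x => by positivity) N)
    (fun x => by positivity)).mono fun x => hh (m x)

end PolyBounded

namespace SchwartzMap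

variable {X Y : Type*} [NormedAddCommGroup X] [NormedAddCommGroup Y]
variable {V : Type*} [NormedAddCommGroup V] [NormedSpace ℝ V]
variable {H : Type*} [NormedAddCommGroup H] [NormedSpace ℝ H]
variable {W : Type*} [NormedAddCommGroup W] [NormedSpace ℝ W]
variable {K : Type*} [NormedAddCommGroup K] [NormedSpace ℝ K]

/-! ### Translations -/

/-- Moves the polynomial weight from `y` to a point `w` at controlled distance: `‖y‖` is at most
`2(1 + r)` if `‖w‖ ≤ 1`, and at most `2(1 + r)‖w‖` otherwise. -/
theorem norm_pow_mul_iteratedFDeriv_le_of_norm_le (f : 𝓢(V, H)) (k l : ℕ) {y w : V} {r : ℝ}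
    (hr : 0 ≤ r) (hy : ‖y‖ ≤ ‖w‖ + r) :
    ‖y‖ ^ k * ‖iteratedFDeriv ℝ l f w‖ ≤ (2 * (1 + r)) ^ k *
      (SchwartzMap.seminorm ℝ 0 l f + SchwartzMap.seminorm ℝ k l f) := by
  have h0 := le_seminorm ℝ 0 l f w
  have hk := le_seminorm ℝ k l f w
  rw [pow_zero, one_mul] at h0
  have h1 : ‖y‖ ^ k ≤ (2 * (1 + r)) ^ k * (1 + ‖w‖ ^ k) := by
    rcases le_total ‖w‖ 1 with hw | hw
    · calc ‖y‖ ^ k ≤ (2 * (1 + r)) ^ k := by gcongr; linarith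
        _ ≤ (2 * (1 + r)) ^ k * (1 + ‖w‖ ^ k) :=
          le_mul_of_one_le_right (by positivity) (by linarith [pow_nonneg (norm_nonneg w) k])
    · calc ‖y‖ ^ k ≤ (2 * (1 + r) * ‖w‖) ^ k := by gcongr; nlinarith
        _ = (2 * (1 + r)) ^ k * ‖w‖ ^ k := mul_pow _ _ _
        _ ≤ _ := by gcongr; linarith
  calc ‖y‖ ^ k * ‖iteratedFDeriv ℝ l f w‖
      ≤ ((2 * (1 + r)) ^ k * (1 + ‖w‖ ^ k)) * ‖iteratedFDeriv ℝ l f w‖ := by gcongr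
    _ = (2 * (1 + r)) ^ k *
      (‖iteratedFDeriv ℝ l f w‖ + ‖w‖ ^ k * ‖iteratedFDeriv ℝ l f w‖) := by ring
    _ ≤ _ := by gcongr

theorem iteratedFDeriv_compSubConstCLM (a : V) (f : 𝓢(V, H)) (l : ℕ) (y : V) :
    iteratedFDeriv ℝ l (compSubConstCLM ℝ a f) y = iteratedFDeriv ℝ l f (y - a) :=
  iteratedFDeriv_comp_sub l a y

theorem seminorm_compSubConstCLM_le (a : V) (f : 𝓢(V, H)) (k l : ℕ) :
    SchwartzMap.seminorm ℝ k l (compSubConstCLM ℝ a f) ≤ (2 * (1 + ‖a‖)) ^ k *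
      (SchwartzMap.seminorm ℝ 0 l f + SchwartzMap.seminorm ℝ k l f) := by
  refine seminorm_le_bound ℝ k l _ (by positivity) fun y => ?_
  rw [iteratedFDeriv_compSubConstCLM]
  refine norm_pow_mul_iteratedFDeriv_le_of_norm_le f k l (norm_nonneg a) ?_
  calc ‖y‖ = ‖(y - a) + a‖ := by rw [sub_add_cancel]
    _ ≤ _ := norm_add_le _ _

/-- Mean value inequality on the segment from `y - b` to `y - a`, at the cost of one derivative. -/
theorem seminorm_compSubConstCLM_sub_le (a b : V) (f : 𝓢(V, H)) (k l : ℕ) :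
    SchwartzMap.seminorm ℝ k l (compSubConstCLM ℝ a f - compSubConstCLM ℝ b f)
      ≤ (2 * (1 + (‖a‖ + ‖b‖))) ^ k *
      (SchwartzMap.seminorm ℝ 0 (l + 1) f + SchwartzMap.seminorm ℝ k (l + 1) f) * ‖a - b‖ := by
  refine seminorm_le_bound ℝ k l _ (by positivity) fun y => ?_
  have h1 : iteratedFDeriv ℝ l (⇑(compSubConstCLM ℝ a f - compSubConstCLM ℝ b f)) y
      = iteratedFDeriv ℝ l f (y - a) - iteratedFDeriv ℝ l f (y - b) := by
    rw [← iteratedFDeriv_compSubConstCLM, ← iteratedFDeriv_compSubConstCLM,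
      ← coe_iteratedFDerivCLM, ← coe_iteratedFDerivCLM, ← coe_iteratedFDerivCLM, map_sub]
    rfl
  rw [h1]
  -- The derivative bound is obtained after division by `‖y‖ ^ k`, so `y = 0` is separate; there
  -- only `k = 0` has content.
  rcases eq_or_ne y 0 with hy | hy
  swap
  all_goals
    have hseg : ∀ w ∈ segment ℝ (y - b) (y - a), ‖y‖ ≤ ‖w‖ + (‖a‖ + ‖b‖) := by
      rintro w ⟨s, t, hs, ht, hst, rfl⟩
      have : y = (s • (y - b) + t • (y - a)) + (s • b + t • a) := by
        have : s = 1 - t := by linarith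
        subst this
        module
      calc ‖y‖ ≤ ‖s • (y - b) + t • (y - a)‖ + ‖s • b + t • a‖ := by
            conv_lhs => rw [this]
            exact norm_add_le _ _
        _ ≤ _ := by
          gcongr
          refine (norm_add_le _ _).trans ?_
          rw [norm_smul, norm_smul, Real.norm_of_nonneg hs, Real.norm_of_nonneg ht]
          nlinarith [norm_nonneg a, norm_nonneg b]
    have hdiff : ∀ w ∈ segment ℝ (y - b) (y - a),
        DifferentiableAt ℝ (iteratedFDeriv ℝ l f) w := fun w _ => by
      rw [← coe_iteratedFDerivCLM]
      exact (iteratedFDerivCLM V H l f).differentiableAt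
  · have hb : ∀ w ∈ segment ℝ (y - b) (y - a), ‖fderiv ℝ (iteratedFDeriv ℝ l f) w‖
        ≤ (2 * (1 + (‖a‖ + ‖b‖))) ^ k * (SchwartzMap.seminorm ℝ 0 (l + 1) f
          + SchwartzMap.seminorm ℝ k (l + 1) f) / ‖y‖ ^ k := fun w hw => by
      rw [le_div_iff₀ (by positivity), mul_comm, norm_fderiv_iteratedFDeriv]
      exact norm_pow_mul_iteratedFDeriv_le_of_norm_le f k (l + 1) (by positivity) (hseg w hw)
    have := Convex.norm_image_sub_le_of_norm_fderiv_le hdiff hb (convex_segment _ _)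
      (left_mem_segment ℝ _ _) (right_mem_segment ℝ _ _)
    rw [sub_sub_sub_cancel_left, norm_sub_rev b a, div_mul_eq_mul_div,
      le_div_iff₀ (by positivity)] at this
    linarith
  · rcases Nat.eq_zero_or_pos k with hk | hk
    · subst hk
      have hb : ∀ w ∈ segment ℝ (y - b) (y - a), ‖fderiv ℝ (iteratedFDeriv ℝ l f) w‖
        ≤ (2 * (1 + (‖a‖ + ‖b‖))) ^ 0 * (SchwartzMap.seminorm ℝ 0 (l + 1) f
          + SchwartzMap.seminorm ℝ 0 (l + 1) f) := fun w hw => by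
        rw [norm_fderiv_iteratedFDeriv]
        simpa using norm_pow_mul_iteratedFDeriv_le_of_norm_le f 0 (l + 1)
          (add_nonneg (norm_nonneg a) (norm_nonneg b)) (hseg w hw)
      have := Convex.norm_image_sub_le_of_norm_fderiv_le hdiff hb (convex_segment _ _)
        (left_mem_segment ℝ _ _) (right_mem_segment ℝ _ _)
      rw [sub_sub_sub_cancel_left, norm_sub_rev b a] at this
      simpa using this
    · rw [hy, norm_zero, zero_pow hk.ne', zero_mul]
      positivity

/-- Joint continuity in the vector and the function. Moving the function is controlled by a
polynomial factor that is locally bounded in the vector, moving the vector by the Lipschitz estimate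
above. -/
theorem continuous_compSubConstCLM :
    Continuous fun q : V × 𝓢(V, H) => compSubConstCLM ℝ q.1 q.2 := by
  rw [continuous_iff_continuousAt]
  rintro ⟨a, f⟩
  refine ((schwartz_withSeminorms ℝ V H).tendsto_nhds _ _).2 ?_
  rintro ⟨k, l⟩ ε hε
  have hcs : ∀ k l, Continuous fun f : 𝓢(V, H) => SchwartzMap.seminorm ℝ k l f := fun k l =>
    (schwartz_withSeminorms ℝ V H).continuous_seminorm (k, l)
  have hlim : Filter.Tendsto (fun q : V × 𝓢(V, H) => (2 * (1 + ‖q.1‖)) ^ k *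
      (SchwartzMap.seminorm ℝ 0 l (q.2 - f) + SchwartzMap.seminorm ℝ k l (q.2 - f))
      + (2 * (1 + (‖q.1‖ + ‖a‖))) ^ k *
      (SchwartzMap.seminorm ℝ 0 (l + 1) f + SchwartzMap.seminorm ℝ k (l + 1) f) * ‖q.1 - a‖)
      (nhds (a, f)) (nhds 0) := by
    have hc : Continuous (fun q : V × 𝓢(V, H) => (2 * (1 + ‖q.1‖)) ^ k *
      (SchwartzMap.seminorm ℝ 0 l (q.2 - f) + SchwartzMap.seminorm ℝ k l (q.2 - f))
      + (2 * (1 + (‖q.1‖ + ‖a‖))) ^ k *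
      (SchwartzMap.seminorm ℝ 0 (l + 1) f + SchwartzMap.seminorm ℝ k (l + 1) f)
        * ‖q.1 - a‖) := by
      have h1 := (hcs 0 l).comp (continuous_snd.sub continuous_const :
        Continuous fun q : V × 𝓢(V, H) => q.2 - f)
      have h2 := (hcs k l).comp (continuous_snd.sub continuous_const :
        Continuous fun q : V × 𝓢(V, H) => q.2 - f)
      simp only [Function.comp_def] at h1 h2
      fun_prop
    have := hc.tendsto (a, f)
    simpa using this
  filter_upwards [hlim.eventually (gt_mem_nhds hε)] with q hq
  refine lt_of_le_of_lt ?_ hq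
  have : compSubConstCLM ℝ q.1 q.2 - compSubConstCLM ℝ a f
      = compSubConstCLM ℝ q.1 (q.2 - f) + (compSubConstCLM ℝ q.1 f - compSubConstCLM ℝ a f) := by
    rw [map_sub]; abel
  simp only [this]
  refine (map_add_le_add _ _ _).trans (add_le_add ?_ ?_)
  · exact seminorm_compSubConstCLM_le q.1 (q.2 - f) k l
  · exact seminorm_compSubConstCLM_sub_le q.1 a f k l

/-! ### Temperate families -/

/-- A continuous family of Schwartz functions whose seminorms grow at most polynomially. -/
structure TemperateFamily (P : X → 𝓢(V, H)) : Prop where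
  continuous : Continuous P
  growth : ∀ k l : ℕ, PolyBounded fun x => SchwartzMap.seminorm ℝ k l (P x)

theorem TemperateFamily.const (f : 𝓢(V, H)) : TemperateFamily fun _ : X => f :=
  ⟨continuous_const, fun _ _ => PolyBounded.const _⟩

theorem TemperateFamily.map {P : X → 𝓢(V, H)} (hP : TemperateFamily P)
    (T : 𝓢(V, H) →L[ℝ] 𝓢(W, K)) : TemperateFamily fun x => T (P x) := by
  refine ⟨T.continuous.comp hP.continuous, fun k l => ?_⟩
  obtain ⟨s, C, hC, h⟩ := exists_seminorm_comp_le_sum T k l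
  exact ((PolyBounded.const C).mul (PolyBounded.sum fun i _ => hP.growth i.1 i.2)
    fun x => Finset.sum_nonneg fun i _ => apply_nonneg _ _).mono fun x => h (P x)

theorem TemperateFamily.comp {P : Y → 𝓢(V, H)} (hP : TemperateFamily P) {m : X → Y}
    (hm : Continuous m) (hm' : PolyBounded fun x => ‖m x‖) : TemperateFamily fun x => P (m x) :=
  ⟨hP.continuous.comp hm, fun k l => (hP.growth k l).comp hm'⟩

theorem TemperateFamily.translate {P : X → 𝓢(V, H)} (hP : TemperateFamily P) {m : X → V}
    (hm : Continuous m) (hm' : PolyBounded fun x => ‖m x‖) :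
    TemperateFamily fun x => compSubConstCLM ℝ (m x) (P x) := by
  refine ⟨continuous_compSubConstCLM.comp (hm.prodMk hP.continuous), fun k l => ?_⟩
  refine PolyBounded.mono ?_ fun x => seminorm_compSubConstCLM_le (m x) (P x) k l
  exact (((PolyBounded.const 2).mul ((PolyBounded.const 1).add hm') fun x => by positivity).pow
    (fun x => by positivity) k).mul ((hP.growth 0 l).add (hP.growth k l)) fun x => by positivity

/-! ### Rapidly decaying coefficients -/

/-- A continuous function decaying faster than any power. -/
structure RapidDecay (G : X → ℂ) : Prop where
  continuous : Continuous G
  decay : ∀ N : ℕ, ∃ C, 0 ≤ C ∧ ∀ x, ‖G x‖ * (1 + ‖x‖) ^ N ≤ C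

theorem RapidDecay.mul_bounded {G : X → ℂ} (hG : RapidDecay G) {c : X → ℂ} (hc : Continuous c)
    {M : ℝ} (hM : ∀ x, ‖c x‖ ≤ M) : RapidDecay fun x => c x * G x := by
  refine ⟨hc.mul hG.continuous, fun N => ?_⟩
  obtain ⟨C, hC, h⟩ := hG.decay N
  have hM0 : 0 ≤ M := (norm_nonneg _).trans (hM 0)
  refine ⟨M * C, by positivity, fun x => ?_⟩
  rw [norm_mul, mul_assoc]
  exact mul_le_mul (hM x) (h x) (by positivity) hM0

theorem rapidDecay (f : 𝓢(V, ℂ)) : RapidDecay f := by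
  refine ⟨f.continuous, fun N => ?_⟩
  refine ⟨2 ^ N * ((Finset.Iic (N, 0)).sup fun m => SchwartzMap.seminorm ℝ m.1 m.2) f,
    by positivity, fun x => ?_⟩
  have := one_add_le_sup_seminorm_apply (𝕜 := ℝ) (m := (N, 0)) le_rfl le_rfl f x
  rw [norm_iteratedFDeriv_zero] at this
  rw [mul_comm]
  exact this

theorem RapidDecay.comp {G : Y → ℂ} (hG : RapidDecay G) {m : X → Y} (hm : Continuous m)
    {C : ℝ} (hC : ∀ x, ‖x‖ ≤ C * (1 + ‖m x‖)) : RapidDecay fun x => G (m x) := by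
  refine ⟨hG.continuous.comp hm, fun N => ?_⟩
  obtain ⟨D, hD, h⟩ := hG.decay N
  refine ⟨(1 + |C|) ^ N * D, by positivity, fun x => ?_⟩
  have h1 : 1 + ‖x‖ ≤ (1 + |C|) * (1 + ‖m x‖) := by
    have := hC x
    have h2 : C * (1 + ‖m x‖) ≤ |C| * (1 + ‖m x‖) := by gcongr; exact le_abs_self C
    nlinarith [norm_nonneg (m x)]
  calc ‖G (m x)‖ * (1 + ‖x‖) ^ N ≤ ‖G (m x)‖ * ((1 + |C|) * (1 + ‖m x‖)) ^ N := by gcongr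
    _ = (1 + |C|) ^ N * (‖G (m x)‖ * (1 + ‖m x‖) ^ N) := by rw [mul_pow]; ring
    _ ≤ _ := by gcongr; exact h (m x)

section Integrable

variable [NormedSpace ℝ X] [FiniteDimensional ℝ X] [MeasurableSpace X] [BorelSpace X]
  {μ : Measure X} [μ.IsAddHaarMeasure]

theorem RapidDecay.integrable_mul_polyBounded {G : X → ℂ} (hG : RapidDecay G) {f : X → ℝ}
    (hf : PolyBounded f) (hf0 : ∀ x, 0 ≤ f x) (hfm : AEStronglyMeasurable f μ) :
    Integrable (fun x => ‖G x‖ * f x) μ := by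
  obtain ⟨C, N, hC, h⟩ := hf
  -- The first `N` powers absorb the growth of `f`; the other `dim X + 1` leave an integrable
  -- majorant.
  obtain ⟨D, hD, hG'⟩ := hG.decay (N + (Module.finrank ℝ X + 1))
  have hi : Integrable (fun x : X => (1 + ‖x‖) ^ (-((Module.finrank ℝ X + 1 : ℕ) : ℝ))) μ :=
    integrable_one_add_norm (by push_cast; linarith)
  refine Integrable.mono' (hi.const_mul (C * D))
    (hG.continuous.norm.aestronglyMeasurable.mul hfm) (Filter.Eventually.of_forall fun x => ?_)
  have hx : 0 < 1 + ‖x‖ := by positivity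
  rw [Real.norm_of_nonneg (mul_nonneg (norm_nonneg _) (hf0 x)), Real.rpow_neg hx.le,
    Real.rpow_natCast, ← div_eq_mul_inv, le_div_iff₀ (by positivity)]
  calc ‖G x‖ * f x * (1 + ‖x‖) ^ (Module.finrank ℝ X + 1)
      ≤ ‖G x‖ * (C * (1 + ‖x‖) ^ N) * (1 + ‖x‖) ^ (Module.finrank ℝ X + 1) := by
        gcongr; exact h x
    _ = C * (‖G x‖ * (1 + ‖x‖) ^ (N + (Module.finrank ℝ X + 1))) := by rw [pow_add]; ring
    _ ≤ _ := by gcongr; exact hG' x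

theorem RapidDecay.integrable {G : X → ℂ} (hG : RapidDecay G) : Integrable G μ := by
  have := hG.integrable_mul_polyBounded (μ := μ) (PolyBounded.const 1) (fun _ => zero_le_one)
    aestronglyMeasurable_const
  simp only [mul_one] at this
  exact (integrable_norm_iff hG.continuous.aestronglyMeasurable).1 this

theorem RapidDecay.integrableFamily {G : X → ℂ} (hG : RapidDecay G) {P : X → 𝓢(V, ℂ)}
    (hP : TemperateFamily P) : IntegrableFamily (fun x => G x • P x) μ := by
  refine ⟨hG.continuous.smul hP.continuous, fun k l => ?_⟩
  have h : ∀ x, SchwartzMap.seminorm ℝ k l (G x • P x)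
      = ‖G x‖ * SchwartzMap.seminorm ℝ k l (P x) := fun x =>
    map_smul_eq_mul (SchwartzMap.seminorm ℂ k l) (G x) (P x)
  simp only [h]
  refine hG.integrable_mul_polyBounded (hP.growth k l) (fun x => apply_nonneg _ _) ?_
  exact (((schwartz_withSeminorms ℝ V ℂ).continuous_seminorm (k, l)).comp
      hP.continuous).aestronglyMeasurable

end Integrable

/-- A rapidly decaying superposition of a temperate family is a Schwartz function, and tempered
distributions may be applied under the integral sign. -/
theorem exists_integral_smul {V : Type*} [NormedAddCommGroup V] [InnerProductSpace ℝ V]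
    [FiniteDimensional ℝ V] [NormedSpace ℝ X] [FiniteDimensional ℝ X] [MeasurableSpace X]
    [BorelSpace X] {μ : Measure X} [μ.IsAddHaarMeasure] {G : X → ℂ} (hG : RapidDecay G)
    {P : X → 𝓢(V, ℂ)} (hP : TemperateFamily P) :
    ∃ F : 𝓢(V, ℂ), (∀ y, F y = ∫ x, G x * P x y ∂μ) ∧
      ∀ u : 𝓢'(V, ℂ), Integrable (fun x => G x * u (P x)) μ ∧
        u F = ∫ x, G x * u (P x) ∂μ := by
  have h := hG.integrableFamily (μ := μ) hP
  refine ⟨h.integral, fun y => h.integral_apply y, fun u => ?_⟩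
  let u' : 𝓢(V, ℂ) →L[ℝ] ℂ := ContinuousLinearMap.restrictScalars ℝ
    (show 𝓢(V, ℂ) →L[ℂ] ℂ from u)
  have hu : ∀ x, u' (G x • P x) = G x * u (P x) := fun x => map_smul u (G x) (P x)
  have h1 := h.integrable_clm u'
  have h2 := h.clm_integral u'
  simp only [hu] at h1 h2
  exact ⟨h1, h2⟩

end SchwartzMap

namespace SchwartzMap


/-! ### Tensor products -/

section Tensor

variable {E F : Type*} [NormedAddCommGroup E] [NormedSpace ℝ E] [NormedAddCommGroup F]
  [NormedSpace ℝ F]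

theorem norm_iteratedFDeriv_comp_clm_le {D : Type*} [NormedAddCommGroup D] [NormedSpace ℝ D]
    (f : 𝓢(E, ℂ)) (g : D →L[ℝ] E) (hg : ‖g‖ ≤ 1) (i : ℕ) (x : D) :
    ‖iteratedFDeriv ℝ i (fun x => f (g x)) x‖ ≤ ‖iteratedFDeriv ℝ i f (g x)‖ := by
  have h := g.iteratedFDeriv_comp_right (f.smooth i) x le_rfl
  rw [show (fun x => f (g x)) = f ∘ g from rfl, h]
  refine (ContinuousMultilinearMap.norm_compContinuousLinearMap_le _ _).trans ?_
  refine mul_le_of_le_one_right (norm_nonneg _) ?_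
  exact Finset.prod_le_one (fun _ _ => norm_nonneg _) fun _ _ => hg

/-- The tensor product of two Schwartz functions. -/
noncomputable def tensor (f : 𝓢(E, ℂ)) (g : 𝓢(F, ℂ)) : 𝓢(E × F, ℂ) where
  toFun z := f z.1 * g z.2
  smooth' := ((f.smooth ⊤).comp contDiff_fst).mul ((g.smooth ⊤).comp contDiff_snd)
  decay' k l := by
    refine ⟨∑ i ∈ Finset.range (l + 1), (l.choose i : ℝ) *
      (SchwartzMap.seminorm ℝ k i f * SchwartzMap.seminorm ℝ 0 (l - i) g
        + SchwartzMap.seminorm ℝ 0 i f * SchwartzMap.seminorm ℝ k (l - i) g), fun z => ?_⟩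
    -- Leibniz's rule distributes the derivatives. The norm on the product is a maximum, so `‖z‖ ^
    -- k` is at most a sum of two weights, each absorbed by one factor.
    have h1 := norm_iteratedFDeriv_mul_le (𝕜 := ℝ) (N := l)
      ((f.smooth l).comp (contDiff_fst (E := E) (F := F)))
      ((g.smooth l).comp (contDiff_snd (E := E) (F := F))) z le_rfl
    refine (mul_le_mul_of_nonneg_left h1 (by positivity)).trans ?_
    rw [Finset.mul_sum]
    refine Finset.sum_le_sum fun i _ => ?_
    have hf := norm_iteratedFDeriv_comp_clm_le f (ContinuousLinearMap.fst ℝ E F)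
      (ContinuousLinearMap.norm_fst_le ℝ E F) i z
    have hg := norm_iteratedFDeriv_comp_clm_le g (ContinuousLinearMap.snd ℝ E F)
      (ContinuousLinearMap.norm_snd_le ℝ E F) (l - i) z
    have f0 := le_seminorm ℝ 0 i f z.1
    have fk := le_seminorm ℝ k i f z.1
    have g0 := le_seminorm ℝ 0 (l - i) g z.2
    have gk := le_seminorm ℝ k (l - i) g z.2
    rw [pow_zero, one_mul] at f0 g0
    have hz : ‖z‖ ^ k ≤ ‖z.1‖ ^ k + ‖z.2‖ ^ k := by
      rw [Prod.norm_def]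
      rcases max_cases ‖z.1‖ ‖z.2‖ with h | h <;> rw [h.1]
      · exact le_add_of_nonneg_right (by positivity)
      · exact le_add_of_nonneg_left (by positivity)
    calc _ ≤ (‖z.1‖ ^ k + ‖z.2‖ ^ k) * ((l.choose i : ℝ) * ‖iteratedFDeriv ℝ i f z.1‖
          * ‖iteratedFDeriv ℝ (l - i) g z.2‖) := by
          refine mul_le_mul hz ?_ (by positivity) (by positivity)
          exact mul_le_mul (mul_le_mul_of_nonneg_left hf (by positivity)) hg (norm_nonneg _)
            (by positivity)
      _ = (l.choose i : ℝ) * ((‖z.1‖ ^ k * ‖iteratedFDeriv ℝ i f z.1‖)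
            * ‖iteratedFDeriv ℝ (l - i) g z.2‖
          + ‖iteratedFDeriv ℝ i f z.1‖
            * (‖z.2‖ ^ k * ‖iteratedFDeriv ℝ (l - i) g z.2‖)) := by ring
      _ ≤ _ := by gcongr

end Tensor

/-! ### Partial Fourier transform -/

section PartialFourier

variable {E U : Type} [NormedAddCommGroup E] [InnerProductSpace ℝ E]
  [NormedAddCommGroup U] [InnerProductSpace ℝ U] [FiniteDimensional ℝ U] [MeasurableSpace U]
  [BorelSpace U]
variable {H : Type} [NormedAddCommGroup H] [NormedSpace ℂ H] [CompleteSpace H]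

/-- The restriction of a Schwartz function on a product to a fibre. -/
noncomputable def slice (F : 𝓢(E × U, H)) (x : E) : 𝓢(U, H) :=
  compCLM ℝ (g := fun τ : U => (x, τ))
    (by
      have h := (Function.HasTemperateGrowth.const (x, (0 : U))).add
        (ContinuousLinearMap.inr ℝ E U).hasTemperateGrowth
      convert h using 1
      funext τ
      simp)
    ⟨1, 1, fun τ => by
      have : ‖τ‖ ≤ ‖(x, τ)‖ := norm_snd_le (x, τ)
      simp only [pow_one, one_mul]
      linarith⟩ F

theorem slice_apply (F : 𝓢(E × U, H)) (x : E) (τ : U) : slice F x τ = F (x, τ) := rfl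

/-- The Fourier transform of a Schwartz function on a product in the second variable. -/
noncomputable def partialFourier (F : 𝓢(E × U, H)) (z : E × U) : H :=
  𝓕 (slice F z.1) z.2

theorem partialFourier_eq (F : 𝓢(E × U, H)) (z : E × U) :
    partialFourier F z = ∫ τ, cexp (↑(-2 * Real.pi * ⟪τ, z.2⟫) * I) • F (z.1, τ) := by
  rw [partialFourier, fourier_coe, Real.fourier_eq']
  rfl

theorem norm_exp_character (t : ℝ) : ‖cexp (t * I)‖ = 1 := norm_exp_ofReal_mul_I t

/-- Joint decay in `(x, τ)` implies decay in `τ` uniformly in `x`. This single majorant serves both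
for boundedness and for differentiation of the partial transform. -/
theorem exists_integrable_bound_slice (F : 𝓢(E × U, H)) :
    ∃ b : U → ℝ, Integrable b ∧ ∀ x τ, ‖F (x, τ)‖ ≤ b τ := by
  let r := Module.finrank ℝ U + 1
  let C := 2 ^ r * ((Finset.Iic (r, 0)).sup fun m => SchwartzMap.seminorm ℝ m.1 m.2) F
  have hi : Integrable (fun τ : U => (1 + ‖τ‖) ^ (-(r : ℝ))) :=
    integrable_one_add_norm (by simp [r])
  refine ⟨fun τ => C * (1 + ‖τ‖) ^ (-(r : ℝ)), hi.const_mul C, fun x τ => ?_⟩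
  have h := one_add_le_sup_seminorm_apply (𝕜 := ℝ) (m := (r, 0)) le_rfl le_rfl F (x, τ)
  rw [norm_iteratedFDeriv_zero] at h
  have hpos : 0 < 1 + ‖τ‖ := by positivity
  change _ ≤ C * (1 + ‖τ‖) ^ (-(r : ℝ))
  rw [Real.rpow_neg hpos.le, Real.rpow_natCast, ← div_eq_mul_inv, le_div_iff₀ (by positivity)]
  refine le_trans ?_ h
  rw [mul_comm]
  have : ‖τ‖ ≤ ‖(x, τ)‖ := norm_snd_le (x, τ)
  gcongr

theorem continuous_character_smul_slice (F : 𝓢(E × U, H)) (z : E × U) :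
    Continuous fun τ => cexp (↑(-2 * Real.pi * ⟪τ, z.2⟫) * I) • F (z.1, τ) := by
  have : Continuous fun τ : U => F (z.1, τ) := F.continuous.comp (by fun_prop)
  fun_prop

theorem integrable_character_smul_slice (F : 𝓢(E × U, H)) (z : E × U) :
    Integrable fun τ => cexp (↑(-2 * Real.pi * ⟪τ, z.2⟫) * I) • F (z.1, τ) := by
  obtain ⟨b, hb, h⟩ := exists_integrable_bound_slice F
  refine hb.mono' (continuous_character_smul_slice F z).aestronglyMeasurable
    (Filter.Eventually.of_forall fun τ => ?_)
  rw [norm_smul, norm_exp_character, one_mul]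
  exact h _ _

theorem exists_bound_partialFourier (F : 𝓢(E × U, H)) : ∃ C, ∀ z, ‖partialFourier F z‖ ≤ C := by
  obtain ⟨b, hb, h⟩ := exists_integrable_bound_slice F
  refine ⟨∫ τ, b τ, fun z => ?_⟩
  rw [partialFourier_eq]
  refine norm_integral_le_of_norm_le hb (Filter.Eventually.of_forall fun τ => ?_)
  rw [norm_smul, norm_exp_character, one_mul]
  exact h z.1 τ

/-- The Schwartz function whose partial Fourier transform is the derivative of the partial Fourier
transform of `F`. -/
noncomputable def partialFourierDeriv (F : 𝓢(E × U, H)) : 𝓢(E × U, (E × U) →L[ℝ] H) :=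
  postcompCLM (𝕜 := ℝ) ((ContinuousLinearMap.compL ℝ (E × U) (E × U) H).flip
      ((ContinuousLinearMap.inl ℝ E U).comp (ContinuousLinearMap.fst ℝ E U)))
      (fderivCLM ℝ (E × U) H F)
    + (-2 * Real.pi * I : ℂ) • smulRightCLM ℂ H
      (((innerSL ℝ).bilinearComp (ContinuousLinearMap.snd ℝ E U)
        (ContinuousLinearMap.snd ℝ E U))) F

theorem partialFourierDeriv_apply (F : 𝓢(E × U, H)) (z m : E × U) :
    partialFourierDeriv F z m
      = fderiv ℝ F z (m.1, 0) + (-2 * Real.pi * I : ℂ) • ((⟪z.2, m.2⟫ : ℝ) • F z) := rfl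

/-- The derivative in the first variable falls on `F`; in the second it falls on the character and
brings down a factor linear in `τ`. Both terms are Schwartz, so the derivative is again a partial
Fourier transform, with values in a larger space. -/
theorem hasFDerivAt_partialFourier (F : 𝓢(E × U, H)) (z : E × U) :
    HasFDerivAt (partialFourier F) (partialFourier (H := (E × U) →L[ℝ] H) (partialFourierDeriv F) z) z := by
  have e : partialFourier F
      = fun z => ∫ τ, cexp (↑(-2 * Real.pi * ⟪τ, z.2⟫) * I) • F (z.1, τ) :=
    funext (partialFourier_eq F)
  rw [e, partialFourier_eq]
  obtain ⟨b, hb, hbF⟩ := exists_integrable_bound_slice (H := (E × U) →L[ℝ] H) (partialFourierDeriv F)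
  refine hasFDerivAt_integral_of_dominated_of_fderiv_le
    (F := fun (z : E × U) τ => cexp (↑(-2 * Real.pi * ⟪τ, z.2⟫) * I) • F (z.1, τ))
    (F' := fun (z : E × U) τ => cexp (↑(-2 * Real.pi * ⟪τ, z.2⟫) * I)
      • partialFourierDeriv F (z.1, τ))
    (bound := b) (s := Set.univ) Filter.univ_mem ?_ ?_ ?_ ?_ hb ?_
  · exact Filter.Eventually.of_forall fun w => (continuous_character_smul_slice F w).aestronglyMeasurable
  · exact integrable_character_smul_slice F z
  · have h := (integrable_character_smul_slice (H := (E × U) →L[ℝ] H)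
      (partialFourierDeriv F) z).aestronglyMeasurable
    exact h
  · refine Filter.Eventually.of_forall fun τ w _ => ?_
    rw [norm_smul, norm_exp_character, one_mul]
    exact hbF _ _
  · refine Filter.Eventually.of_forall fun τ w _ => ?_
    have h1 : HasFDerivAt (fun w : E × U => F (w.1, τ)) ((fderiv ℝ F (w.1, τ)).comp
        ((ContinuousLinearMap.inl ℝ E U).comp (ContinuousLinearMap.fst ℝ E U))) w := by
      refine (F.hasFDerivAt (w.1, τ)).comp w ?_
      have := ((ContinuousLinearMap.inl ℝ E U).comp
        (ContinuousLinearMap.fst ℝ E U)).hasFDerivAt.add_const (c := ((0 : E), τ)) (x := w)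
      refine this.congr_of_eventuallyEq (Filter.Eventually.of_forall fun v => ?_)
      simp
    have h2 : HasFDerivAt (fun w : E × U => -2 * Real.pi * ⟪τ, w.2⟫)
        ((-2 * Real.pi) • ((innerSL ℝ τ).comp (ContinuousLinearMap.snd ℝ E U))) w :=
      (((innerSL ℝ τ).comp (ContinuousLinearMap.snd ℝ E U)).hasFDerivAt).const_mul _
    have h3 := ((Complex.ofRealCLM.hasFDerivAt.comp w h2).mul_const I).cexp.smul h1
    refine h3.congr_fderiv ?_
    refine ContinuousLinearMap.ext fun m => ?_
    simp only [add_apply, smul_apply,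
      partialFourierDeriv_apply, ContinuousLinearMap.comp_apply, Function.comp_apply,
      ContinuousLinearMap.smulRight_apply, Complex.ofRealCLM_apply, innerSL_apply_apply,
      ContinuousLinearMap.coe_snd', ContinuousLinearMap.coe_fst', ContinuousLinearMap.inl_apply,
      smul_add, smul_eq_mul]
    congr 1
    rw [← Complex.coe_smul, smul_smul, smul_smul]
    congr 1
    push_cast
    ring

/-- A factor of the untransformed variable passes through the integral, giving `F₁`. A factor of the
frequency is a derivative before the transform, giving `F₂`, with a constant `2π ≥ 1` to spare. -/
theorem exists_bound_norm_mul_partialFourier (F : 𝓢(E × U, H)) :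
    ∃ (F₁ : 𝓢(E × U, E →L[ℝ] H)) (F₂ : 𝓢(E × U, U →L[ℝ] H)), ∀ z,
      ‖z‖ * ‖partialFourier F z‖ ≤ ‖partialFourier F₁ z‖ + ‖partialFourier F₂ z‖ := by
  let F₁ : 𝓢(E × U, E →L[ℝ] H) :=
    smulRightCLM ℂ H ((innerSL ℝ).comp (ContinuousLinearMap.fst ℝ E U)) F
  let F₂ : 𝓢(E × U, U →L[ℝ] H) :=
    postcompCLM (𝕜 := ℝ) ((ContinuousLinearMap.compL ℝ U (E × U) H).flip
      (ContinuousLinearMap.inr ℝ E U)) (fderivCLM ℝ (E × U) H F)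
  have h1 : ∀ z, ‖z.1‖ * ‖partialFourier F z‖ ≤ ‖partialFourier F₁ z‖ := fun z => by
    have : partialFourier F₁ z = (innerSL ℝ z.1).smulRight (partialFourier F z) := by
      have hi : ∀ x, F₁ (z.1, x) = ContinuousLinearMap.smulRightL ℝ E H (innerSL ℝ z.1)
        (F (z.1, x)) := fun x => rfl
      rw [partialFourier_eq, partialFourier_eq]
      have h2 : (innerSL ℝ z.1).smulRight
          (∫ τ, cexp (↑(-2 * Real.pi * ⟪τ, z.2⟫) * I) • F (z.1, τ))
          = ContinuousLinearMap.smulRightL ℝ E H (innerSL ℝ z.1)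
            (∫ τ, cexp (↑(-2 * Real.pi * ⟪τ, z.2⟫) * I) • F (z.1, τ)) := rfl
      rw [h2, ← ContinuousLinearMap.integral_comp_comm]
      · congr 1
        funext τ
        rw [hi]
        ext m
        exact smul_comm _ _ _
      · exact integrable_character_smul_slice F z
    rw [this, ContinuousLinearMap.norm_smulRight_apply, innerSL_apply_norm]
  have h2 : ∀ z, ‖z.2‖ * ‖partialFourier F z‖ ≤ ‖partialFourier F₂ z‖ := fun z => by
    have hsl : slice F₂ z.1 = fderivCLM ℂ U H (slice F z.1) := by
      ext1 τ
      rw [fderivCLM_apply]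
      have h3 : HasFDerivAt (fun τ : U => F (z.1, τ)) ((fderiv ℝ F (z.1, τ)).comp
          (ContinuousLinearMap.inr ℝ E U)) τ := by
        refine (F.hasFDerivAt (z.1, τ)).comp τ ?_
        have := (ContinuousLinearMap.inr ℝ E U).hasFDerivAt.add_const
          (c := (z.1, (0 : U))) (x := τ)
        refine this.congr_of_eventuallyEq (Filter.Eventually.of_forall fun v => ?_)
        simp
      exact h3.fderiv.symm
    have : partialFourier F₂ z
        = (2 * Real.pi * I : ℂ) • (innerSL ℝ z.2).smulRight (partialFourier F z) := by
      rw [partialFourier, hsl, fourier_fderivCLM_eq]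
      rfl
    rw [this, norm_smul, ContinuousLinearMap.norm_smulRight_apply, innerSL_apply_norm]
    have hpi : (1 : ℝ) ≤ ‖(2 * Real.pi * I : ℂ)‖ := by
      simp only [norm_mul, Complex.norm_ofNat, Complex.norm_real, Complex.norm_I, mul_one]
      rw [Real.norm_of_nonneg Real.pi_pos.le]
      linarith [Real.pi_gt_three]
    exact le_mul_of_one_le_left (by positivity) hpi
  refine ⟨F₁, F₂, fun z => ?_⟩
  rw [Prod.norm_def]
  rcases max_cases ‖z.1‖ ‖z.2‖ with h | h <;> rw [h.1]
  · exact (h1 z).trans (le_add_of_nonneg_right (norm_nonneg _))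
  · exact (h2 z).trans (le_add_of_nonneg_left (norm_nonneg _))

/-- The target space varies in the induction because each power of `‖z‖` is traded for functions
with values in spaces of linear maps. -/
theorem exists_bound_pow_mul_partialFourier (k : ℕ) :
    ∀ {H : Type} [NormedAddCommGroup H] [NormedSpace ℂ H] [CompleteSpace H] (F : 𝓢(E × U, H)),
      ∃ C, ∀ z, ‖z‖ ^ k * ‖partialFourier F z‖ ≤ C := by
  induction k with
  | zero =>
    intro H _ _ _ F
    simpa using exists_bound_partialFourier F
  | succ k ih =>
    intro H _ _ _ F
    obtain ⟨F₁, F₂, h⟩ := exists_bound_norm_mul_partialFourier F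
    obtain ⟨C₁, h₁⟩ := ih F₁
    obtain ⟨C₂, h₂⟩ := ih F₂
    refine ⟨C₁ + C₂, fun z => ?_⟩
    calc ‖z‖ ^ (k + 1) * ‖partialFourier F z‖
        = ‖z‖ ^ k * (‖z‖ * ‖partialFourier F z‖) := by ring
      _ ≤ ‖z‖ ^ k * (‖partialFourier F₁ z‖ + ‖partialFourier F₂ z‖) := by gcongr; exact h z
      _ ≤ C₁ + C₂ := by rw [mul_add]; exact add_le_add (h₁ z) (h₂ z)

theorem fderiv_partialFourier (F : 𝓢(E × U, H)) :
    fderiv ℝ (partialFourier F) = partialFourier (H := (E × U) →L[ℝ] H) (partialFourierDeriv F) :=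
  funext fun z => (hasFDerivAt_partialFourier F z).fderiv

theorem contDiff_partialFourier (l : ℕ) :
    ∀ {H : Type} [NormedAddCommGroup H] [NormedSpace ℂ H] [CompleteSpace H] (F : 𝓢(E × U, H)),
      ContDiff ℝ l (partialFourier F) := by
  induction l with
  | zero =>
    intro H _ _ _ F
    exact contDiff_zero.2 (continuous_iff_continuousAt.2 fun z =>
      (hasFDerivAt_partialFourier F z).continuousAt)
  | succ l ih =>
    intro H _ _ _ F
    push_cast
    refine contDiff_succ_iff_fderiv.2 ⟨fun z => (hasFDerivAt_partialFourier F z).differentiableAt,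
      by simp, ?_⟩
    rw [fderiv_partialFourier]
    exact ih _

theorem exists_bound_iteratedFDeriv_partialFourier (k l : ℕ) :
    ∀ {H : Type} [NormedAddCommGroup H] [NormedSpace ℂ H] [CompleteSpace H] (F : 𝓢(E × U, H)),
      ∃ C, ∀ z, ‖z‖ ^ k * ‖iteratedFDeriv ℝ l (partialFourier F) z‖ ≤ C := by
  induction l with
  | zero =>
    intro H _ _ _ F
    simpa using exists_bound_pow_mul_partialFourier k F
  | succ l ih =>
    intro H _ _ _ F
    obtain ⟨C, h⟩ := ih (H := (E × U) →L[ℝ] H) (partialFourierDeriv F)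
    refine ⟨C, fun z => ?_⟩
    rw [← norm_iteratedFDeriv_fderiv, fderiv_partialFourier]
    exact h z

/-- The partial Fourier transform as a Schwartz function. -/
noncomputable def partialFourierSchwartz (F : 𝓢(E × U, ℂ)) : 𝓢(E × U, ℂ) where
  toFun := partialFourier F
  smooth' := contDiff_infty.2 fun l => contDiff_partialFourier l F
  decay' k l := exists_bound_iteratedFDeriv_partialFourier k l F

theorem partialFourierSchwartz_apply (F : 𝓢(E × U, ℂ)) (z : E × U) :
    partialFourierSchwartz F z = ∫ τ, cexp (↑(-2 * Real.pi * ⟪τ, z.2⟫) * I) * F (z.1, τ) :=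
  partialFourier_eq F z

end PartialFourier

end SchwartzMap

/-! ### The short-time Fourier transform: windows, inversion, change of window -/


section STFT

open SchwartzMap

variable {V : Type} [NormedAddCommGroup V] [InnerProductSpace ℝ V]

@[simp]
theorem schwartzConj_apply (f : 𝓢(V, ℂ)) (x : V) : schwartzConj f x = conj (f x) := rfl

theorem stftWindow_apply (Φ : 𝓢(V, ℂ)) (x ξ y : V) : stftWindow Φ x ξ y
    = cexp (((-(2 * Real.pi * ⟪ξ, y⟫) : ℝ) : ℂ) * I) * conj (Φ (y - x)) := rfl

theorem norm_stftWindow_apply (Φ : 𝓢(V, ℂ)) (x ξ y : V) :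
    ‖stftWindow Φ x ξ y‖ = ‖Φ (y - x)‖ := by
  rw [stftWindow_apply, norm_mul, norm_exp_ofReal_mul_I, one_mul, RCLike.norm_conj]

variable [FiniteDimensional ℝ V] [MeasurableSpace V] [BorelSpace V]

/-- Modulation is translation on the Fourier side. Continuity and polynomial growth of the windows
in `(x, ξ)` thereby reduce to the corresponding facts for translations. -/
theorem stftWindow_eq_fourierInv (Φ : 𝓢(V, ℂ)) (x ξ : V) :
    stftWindow Φ x ξ
      = 𝓕⁻ (compSubConstCLM ℝ (-ξ) (𝓕 (compSubConstCLM ℝ x (schwartzConj Φ)))) := by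
  rw [← FourierTransform.fourierInv_fourier_eq (F := 𝓢(V, ℂ)) (stftWindow Φ x ξ)]
  congr 1
  ext1 η
  rw [compSubConstCLM_apply, fourier_coe, fourier_coe, Real.fourier_eq', Real.fourier_eq']
  congr 1
  funext y
  rw [stftWindow_apply, compSubConstCLM_apply, schwartzConj_apply, smul_eq_mul, smul_eq_mul,
    ← mul_assoc, ← Complex.exp_add, ← add_mul, ← Complex.ofReal_add]
  congr 4
  rw [sub_neg_eq_add, inner_add_right, real_inner_comm y ξ]
  ring

theorem temperateFamily_stftWindow (Φ : 𝓢(V, ℂ)) :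
    TemperateFamily fun q : V × V => stftWindow Φ q.1 q.2 := by
  have h1 : PolyBounded fun q : V × V => ‖q.1‖ := PolyBounded.norm.mono fun q => norm_fst_le q
  have h2 : PolyBounded fun q : V × V => ‖-q.2‖ := PolyBounded.norm.mono fun q => by
    rw [norm_neg]; exact norm_snd_le q
  simp only [stftWindow_eq_fourierInv]
  exact ((((TemperateFamily.const (schwartzConj Φ)).translate continuous_fst h1).map
    (FourierTransform.fourierCLM ℝ _)).translate (by fun_prop) h2).map
    (FourierTransform.fourierInvCLM ℝ _)

theorem continuous_stft (Φ : 𝓢(V, ℂ)) (A : 𝓢'(V, ℂ)) :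
    Continuous fun q : V × V => stft Φ A q.1 q.2 :=
  (show 𝓢(V, ℂ) →L[ℂ] ℂ from A).continuous.comp (temperateFamily_stftWindow Φ).continuous

/-- The linear change of variables `(x, y) ↦ (y, y - x)`. -/
noncomputable def shearEquiv (V : Type) [NormedAddCommGroup V] [NormedSpace ℝ V] : (V × V) ≃L[ℝ] (V × V) :=
  ContinuousLinearEquiv.equivOfInverse
    ((ContinuousLinearMap.snd ℝ V V).prod
      (ContinuousLinearMap.snd ℝ V V - ContinuousLinearMap.fst ℝ V V))
    ((ContinuousLinearMap.fst ℝ V V - ContinuousLinearMap.snd ℝ V V).prod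
      (ContinuousLinearMap.fst ℝ V V))
    (fun z => by simp) (fun z => by simp)

/-- The Schwartz function `(x, y) ↦ f y * γ (y - x)`. -/
noncomputable def overlapKernel (f γ : 𝓢(V, ℂ)) : 𝓢(V × V, ℂ) :=
  compCLMOfContinuousLinearEquiv ℂ (shearEquiv V) (tensor f γ)

theorem overlapKernel_apply (f γ : 𝓢(V, ℂ)) (x y : V) :
    overlapKernel f γ (x, y) = f y * γ (y - x) := rfl

/-- The short-time Fourier transform of a Schwartz function is a Schwartz function. -/
noncomputable def overlap (f γ : 𝓢(V, ℂ)) : 𝓢(V × V, ℂ) :=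
  compCLMOfContinuousLinearEquiv ℂ
    ((ContinuousLinearEquiv.refl ℝ V).prodCongr (ContinuousLinearEquiv.neg ℝ))
    (partialFourierSchwartz (overlapKernel f γ))

theorem overlap_apply (f γ : 𝓢(V, ℂ)) (x ξ : V) :
    overlap f γ (x, ξ) = ∫ y, f y * conj (stftWindow γ x ξ y) := by
  change partialFourierSchwartz (overlapKernel f γ) (x, -ξ) = _
  rw [partialFourierSchwartz_apply]
  congr 1
  funext y
  rw [overlapKernel_apply, stftWindow_apply, map_mul, Complex.conj_conj, ← Complex.exp_conj,
    map_mul, Complex.conj_ofReal, Complex.conj_I, inner_neg_right, real_inner_comm ξ y]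
  change _ * (f y * γ (y - x)) = _
  rw [show ((-2 * Real.pi * -⟪ξ, y⟫ : ℝ) : ℂ) * I
    = ((-(2 * Real.pi * ⟪ξ, y⟫) : ℝ) : ℂ) * -I by push_cast; ring]
  ring

/-- For fixed `x` the coefficient is an inverse Fourier transform in `ξ`, so integrating it against
characters recovers `f y * γ (y - x)`. -/
theorem overlap_eq_fourierInv (f γ : 𝓢(V, ℂ)) (x ξ : V) :
    overlap f γ (x, ξ) = 𝓕⁻ (slice (overlapKernel f γ) x) ξ := by
  rw [fourierInv_apply_eq]
  rfl

/-- Inversion formula for the short-time Fourier transform of a tempered distribution. -/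
theorem stft_inversion (g γ f : 𝓢(V, ℂ)) (u : 𝓢'(V, ℂ)) :
    Integrable (fun q : V × V => overlap f γ q * stft g u q.1 q.2) (volume.prod volume) ∧
    (∫ y, γ y * conj (g y)) * u f
      = ∫ q : V × V, overlap f γ q * stft g u q.1 q.2 ∂(volume.prod volume) := by
  -- The inversion formula is first proved for windows: their superposition `F` is a multiple of
  -- `f`. Applying `u` under the integral gives the statement for distributions.
  obtain ⟨F, hF, hu⟩ := exists_integral_smul (μ := (volume : Measure V).prod volume)
    (rapidDecay (overlap f γ)) (temperateFamily_stftWindow g)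
  have hFf : F = (∫ y, γ y * conj (g y)) • f := by
    ext1 y
    rw [hF, smul_apply, smul_eq_mul]
    have hint : Integrable (fun q : V × V => overlap f γ q * stftWindow g q.1 q.2 y)
        (volume.prod volume) := by
      have hc : Continuous fun q : V × V => stftWindow g q.1 q.2 y := by
        simp only [stftWindow_apply]
        have := g.continuous
        fun_prop
      have := ((rapidDecay (overlap f γ)).mul_bounded hc (M := SchwartzMap.seminorm ℝ 0 0 g)
        fun q => by
          rw [norm_stftWindow_apply]; exact norm_le_seminorm ℝ g _).integrable
          (μ := (volume : Measure V).prod volume)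
      simpa only [mul_comm] using this
    rw [integral_prod _ hint]
    -- Fourier inversion in `ξ` leaves a function of `y - x`, whose integral over `x` does not
    -- depend on `y`.
    have hin : ∀ x, ∫ ξ, overlap f γ (x, ξ) * stftWindow g x ξ y
        = (f y * γ (y - x)) * conj (g (y - x)) := fun x => by
      have h1 : 𝓕 (𝓕⁻ (slice (overlapKernel f γ) x)) y = f y * γ (y - x) := by
        rw [FourierTransform.fourier_fourierInv_eq, slice_apply, overlapKernel_apply]
      rw [fourier_coe, Real.fourier_eq'] at h1
      rw [← h1, ← integral_mul_const]
      congr 1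
      funext ξ
      rw [overlap_eq_fourierInv, stftWindow_apply, smul_eq_mul,
        show -(2 * Real.pi * ⟪ξ, y⟫) = -2 * Real.pi * ⟪ξ, y⟫ by ring]
      ring
    simp only [hin]
    have h2 := integral_sub_left_eq_self (μ := (volume : Measure V))
      (fun x => f y * (γ x * conj (g x))) y
    simp only [← mul_assoc] at h2
    rw [h2]
    simp only [mul_assoc]
    rw [integral_const_mul]
    ring
  refine ⟨(hu u).1, ?_⟩
  have := (hu u).2
  rw [hFf, map_smul, smul_eq_mul] at this
  exact this

theorem integral_mul_conj_self_ne_zero {g : 𝓢(V, ℂ)} (hg : g ≠ 0) :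
    ∫ y, g y * conj (g y) ≠ 0 := by
  intro h
  have h1 : ∀ y, g y * conj (g y) = ((‖g y‖ ^ 2 : ℝ) : ℂ) := fun y => by
    rw [Complex.mul_conj, Complex.normSq_eq_norm_sq]
  simp only [h1] at h
  have h : ∫ y, ‖g y‖ ^ 2 = (0 : ℝ) :=
    Complex.ofReal_eq_zero.1 ((integral_ofReal (𝕜 := ℂ)).symm.trans h)
  have hi : Integrable (fun y => ‖g y‖ ^ 2) := (g.memLp 2 volume).norm.integrable_sq
  rw [integral_eq_zero_iff_of_nonneg (fun y => by positivity) hi] at h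
  have hc : Continuous fun y => ‖g y‖ ^ 2 := by have := g.continuous; fun_prop
  have h2 := (Continuous.ae_eq_iff_eq (μ := (volume : Measure V)) hc continuous_const).1 h
  apply hg
  ext y
  have h3 : ‖g y‖ ^ 2 = 0 := congrFun h2 y
  simpa using h3

/-- Covariance under time-frequency shifts: translating the integration variable by `z` leaves only
a unimodular factor. The overlap of two shifted windows thus acts as a convolution kernel in
modulus. -/
theorem norm_overlap_stftWindow (Φ' γ : 𝓢(V, ℂ)) (z ζ x ξ : V) :
    ‖overlap (stftWindow Φ' z ζ) γ (x, ξ)‖ = ‖overlap (schwartzConj Φ') γ (x - z, ξ - ζ)‖ := by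
  rw [overlap_apply, overlap_apply,
    ← integral_add_right_eq_self (μ := (volume : Measure V)) _ z]
  have : ∀ y, stftWindow Φ' z ζ (y + z) * conj (stftWindow γ x ξ (y + z))
      = cexp (((2 * Real.pi * ⟪ξ - ζ, z⟫ : ℝ) : ℂ) * I) *
        (schwartzConj Φ' y * conj (stftWindow γ (x - z) (ξ - ζ) y)) := fun y => by
    simp only [stftWindow_apply, map_mul, Complex.conj_conj, ← Complex.exp_conj,
      Complex.conj_ofReal, Complex.conj_I, schwartzConj_apply, add_sub_cancel_right]
    rw [show y + z - x = y - (x - z) by abel]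
    have h1 : cexp (((-(2 * Real.pi * ⟪ζ, y + z⟫) : ℝ) : ℂ) * I)
        * cexp (((-(2 * Real.pi * ⟪ξ, y + z⟫) : ℝ) : ℂ) * -I)
        = cexp (((2 * Real.pi * ⟪ξ - ζ, z⟫ : ℝ) : ℂ) * I)
        * cexp (((-(2 * Real.pi * ⟪ξ - ζ, y⟫) : ℝ) : ℂ) * -I) := by
      rw [← Complex.exp_add, ← Complex.exp_add]
      congr 1
      simp only [inner_add_right, inner_sub_left]
      push_cast
      ring
    linear_combination (conj (Φ' y) * γ (y - (x - z))) * h1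
  simp only [this]
  rw [integral_const_mul, norm_mul, norm_exp_ofReal_mul_I, one_mul]

end STFT

/-! ### Polynomial weights -/

section Weight

open SchwartzMap

variable {V W : Type*} [NormedAddCommGroup V] [NormedAddCommGroup W]

/-- The weight `(1 + |v|²)^(s/2)`. -/
noncomputable def polyWeight (s : ℝ) (v : V) : ℝ≥0∞ := ENNReal.ofReal ((1 + ‖v‖ ^ 2) ^ (s / 2))

theorem continuous_rpow_one_add_norm_sq (s : ℝ) :
    Continuous fun v : V => (1 + ‖v‖ ^ 2) ^ (s / 2) := by
  refine Continuous.rpow_const (by fun_prop) fun v => Or.inl (by positivity)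

theorem continuous_polyWeight (s : ℝ) : Continuous (polyWeight s : V → ℝ≥0∞) :=
  ENNReal.continuous_ofReal.comp (continuous_rpow_one_add_norm_sq s)

theorem one_le_polyWeight {s : ℝ} (hs : 0 ≤ s) (v : V) : 1 ≤ polyWeight s v := by
  rw [polyWeight, ENNReal.one_le_ofReal]
  exact Real.one_le_rpow (by nlinarith [sq_nonneg ‖v‖]) (by positivity)

theorem polyWeight_ne_top (s : ℝ) (v : V) : polyWeight s v ≠ ∞ := ENNReal.ofReal_ne_top

/-- Comes from `1 + |a + b|² ≤ 2 (1 + |a|²) (1 + |b|²)`, raised to the power `s/2`. -/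
theorem polyWeight_add_le {s : ℝ} (hs : 0 ≤ s) (a b : V) :
    polyWeight s (a + b) ≤ ENNReal.ofReal (2 ^ (s / 2)) * (polyWeight s a * polyWeight s b) := by
  rw [polyWeight, polyWeight, polyWeight, ← ENNReal.ofReal_mul (by positivity),
    ← ENNReal.ofReal_mul (by positivity), ← Real.mul_rpow (by positivity) (by positivity),
    ← Real.mul_rpow (by positivity) (by positivity)]
  refine ENNReal.ofReal_le_ofReal (Real.rpow_le_rpow (by positivity) ?_ (by positivity))
  have h := norm_add_le a b
  have h2 : ‖a + b‖ ^ 2 ≤ (‖a‖ + ‖b‖) ^ 2 := by gcongr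
  nlinarith [sq_nonneg (‖a‖ - ‖b‖), sq_nonneg (‖a‖ * ‖b‖), sq_nonneg ‖a‖, sq_nonneg ‖b‖]

theorem polyWeight_le_of_norm_le {s M : ℝ} (hs : 0 ≤ s) (hM : 1 ≤ M) {a : V} {b : W}
    (h : ‖a‖ ≤ M * ‖b‖) : polyWeight s a ≤ ENNReal.ofReal ((M ^ 2) ^ (s / 2)) * polyWeight s b := by
  rw [polyWeight, polyWeight, ← ENNReal.ofReal_mul (by positivity),
    ← Real.mul_rpow (by positivity) (by positivity)]
  refine ENNReal.ofReal_le_ofReal (Real.rpow_le_rpow (by positivity) ?_ (by positivity))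
  have h2 : ‖a‖ ^ 2 ≤ (M * ‖b‖) ^ 2 := by gcongr
  nlinarith

theorem polyBounded_weight {s : ℝ} (hs : 0 ≤ s) :
    PolyBounded fun v : V => (1 + ‖v‖ ^ 2) ^ (s / 2) := by
  refine ⟨1, ⌈s⌉₊, zero_le_one, fun v => ?_⟩
  have h1 : 1 + ‖v‖ ^ 2 ≤ (1 + ‖v‖) ^ (2 : ℝ) := by
    rw [Real.rpow_two]; nlinarith [norm_nonneg v]
  calc (1 + ‖v‖ ^ 2) ^ (s / 2) ≤ ((1 + ‖v‖) ^ (2 : ℝ)) ^ (s / 2) := by gcongr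
    _ = (1 + ‖v‖) ^ s := by rw [← Real.rpow_mul (by positivity)]; congr 1; ring
    _ ≤ (1 + ‖v‖) ^ (⌈s⌉₊ : ℝ) :=
      Real.rpow_le_rpow_of_exponent_le (le_add_of_nonneg_right (norm_nonneg v)) (Nat.le_ceil s)
    _ = _ := by rw [Real.rpow_natCast, one_mul]

theorem lintegral_polyWeight_mul_enorm_lt_top [NormedSpace ℝ V] [FiniteDimensional ℝ V]
    [MeasurableSpace V] [BorelSpace V] {μ : Measure V} [μ.IsAddHaarMeasure] {s : ℝ}
    (hs : 0 ≤ s) {G : V → ℂ} (hG : RapidDecay G) :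
    ∫⁻ v, polyWeight s v * ‖G v‖ₑ ∂μ < ∞ := by
  have h := hG.integrable_mul_polyBounded (μ := μ) (polyBounded_weight hs)
    (fun v => by positivity) (continuous_rpow_one_add_norm_sq s).aestronglyMeasurable
  refine lt_of_eq_of_lt (lintegral_congr fun v => ?_) h.hasFiniteIntegral
  rw [enorm_mul, enorm_norm, mul_comm, polyWeight, Real.enorm_of_nonneg (by positivity)]

/-- Submultiplicativity of weighted integrals of convolutions. -/
theorem lintegral_polyWeight_mul_convolution_le [MeasurableSpace V] [BorelSpace V]
    [SecondCountableTopology V] {μ : Measure V} [SFinite μ] [μ.IsAddLeftInvariant]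
    [μ.IsNegInvariant] {s : ℝ} (hs : 0 ≤ s) {m k : V → ℝ≥0∞}
    (hm : Measurable m) (hk : Measurable k) :
    ∫⁻ ζ, polyWeight s ζ * ∫⁻ ξ, m ξ * k (ξ - ζ) ∂μ ∂μ
      ≤ ENNReal.ofReal (2 ^ (s / 2)) * ((∫⁻ ξ, polyWeight s ξ * m ξ ∂μ)
        * ∫⁻ ξ, polyWeight s ξ * k ξ ∂μ) := by
  have hw : Measurable (polyWeight s : V → ℝ≥0∞) := (continuous_polyWeight s).measurable
  have hpt : ∀ ζ, polyWeight s ζ * ∫⁻ ξ, m ξ * k (ξ - ζ) ∂μ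
      ≤ ∫⁻ ξ, ENNReal.ofReal (2 ^ (s / 2)) *
        ((polyWeight s ξ * m ξ) * (polyWeight s (ξ - ζ) * k (ξ - ζ))) ∂μ := fun ζ => by
    rw [← lintegral_const_mul' _ _ (polyWeight_ne_top s ζ)]
    refine lintegral_mono fun ξ => ?_
    have h := polyWeight_add_le hs ξ (-(ξ - ζ))
    have h' : polyWeight s (-(ξ - ζ)) = polyWeight s (ξ - ζ) := by
      simp only [polyWeight, norm_neg]
    rw [h', show ξ + -(ξ - ζ) = ζ by abel] at h
    calc polyWeight s ζ * (m ξ * k (ξ - ζ)) ≤ (ENNReal.ofReal (2 ^ (s / 2)) *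
          (polyWeight s ξ * polyWeight s (ξ - ζ))) * (m ξ * k (ξ - ζ)) := by gcongr
      _ = _ := by ring
  refine (lintegral_mono hpt).trans ?_
  rw [lintegral_lintegral_swap (Measurable.aemeasurable (by fun_prop))]
  have hin : ∀ ξ, ∫⁻ ζ, ENNReal.ofReal (2 ^ (s / 2)) *
        ((polyWeight s ξ * m ξ) * (polyWeight s (ξ - ζ) * k (ξ - ζ))) ∂μ
      = ENNReal.ofReal (2 ^ (s / 2)) * ((polyWeight s ξ * m ξ)
        * ∫⁻ ζ, polyWeight s ζ * k ζ ∂μ) := fun ξ => by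
    rw [lintegral_const_mul _ (by fun_prop), lintegral_const_mul _ (by fun_prop),
      lintegral_sub_left_eq_self (fun ζ => polyWeight s ζ * k ζ) ξ]
  simp only [hin]
  rw [lintegral_const_mul _ (by fun_prop), lintegral_mul_const _ (by fun_prop)]

end Weight

/-! ### Independence of the Sjöstrand bound from the window. -/

section WindowChange

open SchwartzMap

variable {V : Type} [NormedAddCommGroup V] [InnerProductSpace ℝ V] [FiniteDimensional ℝ V]
  [MeasurableSpace V] [BorelSpace V]

/-- The supremum is uncountable, but a supremum of continuous functions is lower semicontinuous. -/
theorem measurable_iSup_enorm_stft (Φ : 𝓢(V, ℂ)) (A : 𝓢'(V, ℂ)) :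
    Measurable fun ζ => ⨆ z, ‖stft Φ A z ζ‖ₑ := by
  refine (lowerSemicontinuous_iSup fun z => ?_).measurable
  refine Continuous.lowerSemicontinuous ?_
  exact ((continuous_stft Φ A).comp (by fun_prop : Continuous fun ζ : V => (z, ζ))).enorm

/-- For a symbol in a weighted Sjöstrand class, short-time Fourier transforms with arbitrary
Schwartz windows are dominated by a weighted integrable function of the frequency. -/
theorem exists_bound_stft_of_window {s : ℝ} (hs : 0 ≤ s) {A : 𝓢'(V, ℂ)} {Φ : 𝓢(V, ℂ)} (hΦ : Φ ≠ 0)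
    (hA : ∫⁻ ζ : V, polyWeight s ζ * ⨆ z, ‖stft Φ A z ζ‖ₑ < ∞) (Φ' : 𝓢(V, ℂ)) :
    ∃ h : V → ℝ≥0∞, Measurable h ∧ (∀ z ζ, ‖stft Φ' A z ζ‖ₑ ≤ h ζ) ∧
      ∫⁻ ζ, polyWeight s ζ * h ζ < ∞ := by
  set c := ∫ y, Φ y * conj (Φ y) with hc
  have hc0 : ‖c‖ₑ ≠ 0 := by
    rw [Ne, enorm_eq_zero]; exact integral_mul_conj_self_ne_zero hΦ
  set G := overlap (schwartzConj Φ') Φ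
  set m : V → ℝ≥0∞ := fun ζ => ⨆ z, ‖stft Φ A z ζ‖ₑ with hm
  have hmm : Measurable m := measurable_iSup_enorm_stft Φ A
  have hGm : Measurable fun q : V × V => ‖G q‖ₑ := G.continuous.enorm.measurable
  set k : V → ℝ≥0∞ := fun ξ => ∫⁻ x, ‖G (x, ξ)‖ₑ with hk
  have hkm : Measurable k := hGm.lintegral_prod_left'
  have hkey : ∀ z ζ, ‖c‖ₑ * ‖stft Φ' A z ζ‖ₑ ≤ ∫⁻ ξ, m ξ * k (ξ - ζ) := fun z ζ => by
    -- Inverting at the shifted window `Φ'` expresses `V_{Φ'} A(z, ζ)` through `V_Φ A`. After the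
    -- supremum over `x` is taken out of `V_Φ A`, the `x`-integral of the kernel is invariant under
    -- translation by `z`, so the bound does not depend on `z`.
    have h1 := (stft_inversion Φ Φ (stftWindow Φ' z ζ) A).2
    have h2 : ‖c‖ₑ * ‖stft Φ' A z ζ‖ₑ ≤ ∫⁻ q : V × V,
        ‖overlap (stftWindow Φ' z ζ) Φ q * stft Φ A q.1 q.2‖ₑ ∂(volume.prod volume) := by
      rw [← enorm_mul, stft, hc, h1]
      exact enorm_integral_le_lintegral_enorm _
    refine h2.trans ?_
    have hcont : Continuous fun q : V × V =>
        ‖overlap (stftWindow Φ' z ζ) Φ q * stft Φ A q.1 q.2‖ₑ :=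
      ((overlap (stftWindow Φ' z ζ) Φ).continuous.mul (continuous_stft Φ A)).enorm
    rw [lintegral_prod_symm _ hcont.measurable.aemeasurable]
    refine lintegral_mono fun ξ => ?_
    have h3 : ∀ x, ‖overlap (stftWindow Φ' z ζ) Φ (x, ξ) * stft Φ A x ξ‖ₑ
        ≤ m ξ * ‖G (x - z, ξ - ζ)‖ₑ := fun x => by
      rw [enorm_mul, mul_comm]
      refine mul_le_mul' (le_iSup (fun x => ‖stft Φ A x ξ‖ₑ) x) (le_of_eq ?_)
      rw [← ofReal_norm, norm_overlap_stftWindow, ofReal_norm]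
    refine (lintegral_mono h3).trans ?_
    have hGx : Measurable fun x : V => ‖G (x, ξ - ζ)‖ₑ :=
      hGm.comp (by fun_prop : Measurable fun x : V => (x, ξ - ζ))
    have hGx' : Measurable fun x : V => ‖G (x - z, ξ - ζ)‖ₑ :=
      hGx.comp (measurable_id.sub_const z)
    rw [lintegral_const_mul _ hGx',
      lintegral_sub_right_eq_self (fun x => ‖G (x, ξ - ζ)‖ₑ) z]
  refine ⟨fun ζ => ‖c‖ₑ⁻¹ * ∫⁻ ξ, m ξ * k (ξ - ζ), ?_, fun z ζ => ?_, ?_⟩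
  · refine Measurable.const_mul ?_ _
    exact Measurable.lintegral_prod_left' (f := fun q : V × V => m q.1 * k (q.1 - q.2))
      (by fun_prop)
  · rw [← ENNReal.mul_le_iff_le_inv hc0 (by finiteness)]
    exact hkey z ζ
  -- The weight in `ξ` is at most the weight of the pair `(x, ξ)`, against which the Schwartz
  -- function `G` is integrable.
  · have hk1 : ∫⁻ ξ, polyWeight s ξ * k ξ < ∞ := by
      have h1 : ∀ ξ, polyWeight s ξ * k ξ = ∫⁻ x, polyWeight s ξ * ‖G (x, ξ)‖ₑ := fun ξ => by
        rw [← lintegral_const_mul' _ _ (polyWeight_ne_top s ξ)]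
      simp only [h1]
      have hwm : Measurable fun q : V × V => polyWeight s q.2 * ‖G q‖ₑ :=
        ((continuous_polyWeight s).comp continuous_snd).measurable.mul hGm
      rw [← lintegral_prod_symm (fun q : V × V => polyWeight s q.2 * ‖G q‖ₑ) hwm.aemeasurable]
      refine lt_of_le_of_lt (lintegral_mono fun q => ?_)
        (lintegral_polyWeight_mul_enorm_lt_top hs (rapidDecay G))
      refine mul_le_mul_left ?_ _
      refine ENNReal.ofReal_le_ofReal ?_
      have := norm_snd_le q
      gcongr
    have h2 : ∀ ζ, polyWeight s ζ * (‖c‖ₑ⁻¹ * ∫⁻ ξ, m ξ * k (ξ - ζ))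
        = ‖c‖ₑ⁻¹ * (polyWeight s ζ * ∫⁻ ξ, m ξ * k (ξ - ζ)) := fun ζ => by ring
    simp only [h2]
    rw [lintegral_const_mul' _ _ (ENNReal.inv_ne_top.2 hc0)]
    refine ENNReal.mul_lt_top (ENNReal.inv_lt_top.2 (pos_iff_ne_zero.2 hc0)) ?_
    exact lt_of_le_of_lt (lintegral_polyWeight_mul_convolution_le hs hmm hkm)
      (ENNReal.mul_lt_top ENNReal.ofReal_lt_top (ENNReal.mul_lt_top hA hk1))

end WindowChange

/-- Only the frequency part of the weight is kept: `1 + |ζ|² ≤ 1 + |z|² + |ζ|²`. It is free of `z`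
and so comes out of the supremum. -/
theorem MemSjostrand.exists_bound_stft {n : ℕ} {s : ℝ} (hs : 0 ≤ s) {A : 𝓢'(PhaseSpace n, ℂ)}
    (hA : MemSjostrand s A) (Φ' : 𝓢(PhaseSpace n, ℂ)) :
    ∃ h : PhaseSpace n → ℝ≥0∞, Measurable h ∧ (∀ z ζ, ‖stft Φ' A z ζ‖ₑ ≤ h ζ) ∧
      ∫⁻ ζ, polyWeight s ζ * h ζ < ∞ := by
  obtain ⟨Φ, hΦ, hA⟩ := hA
  refine exists_bound_stft_of_window hs hΦ (lt_of_le_of_lt (lintegral_mono fun ζ => ?_) hA) Φ'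
  rw [ENNReal.mul_iSup]
  refine iSup_mono fun z => ?_
  rw [mul_comm, polyWeight, ← ofReal_norm, ← ENNReal.ofReal_mul (norm_nonneg _)]
  refine ENNReal.ofReal_le_ofReal (mul_le_mul_of_nonneg_left ?_ (norm_nonneg _))
  refine Real.rpow_le_rpow (by positivity) ?_ (by positivity)
  nlinarith [sq_nonneg ‖z‖]

/-! ### The reproducing formula for wave-packet transforms -/

section WavePacket

open SchwartzMap

/-- Linear change of variables in integrals, up to a constant. -/
theorem exists_integral_eq_smul_integral_comp {E F : Type*} [NormedAddCommGroup E]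
    [NormedSpace ℝ E] [FiniteDimensional ℝ E] [MeasurableSpace E] [BorelSpace E]
    [NormedAddCommGroup F] [NormedSpace ℝ F] [FiniteDimensional ℝ F] [MeasurableSpace F]
    [BorelSpace F] (L : E ≃L[ℝ] F) (μ : Measure E) [μ.IsAddHaarMeasure] (ν : Measure F)
    [ν.IsAddHaarMeasure] :
    ∃ c : ℂ, ∀ f : F → ℂ, ∫ y, f y ∂ν = c * ∫ x, f (L x) ∂μ := by
  have : (Measure.map L μ).IsAddHaarMeasure := L.isAddHaarMeasure_map μ
  have h := Measure.isAddLeftInvariant_eq_smul ν (Measure.map L μ)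
  refine ⟨((ν.addHaarScalarFactor (Measure.map L μ) : ℝ) : ℂ), fun f => ?_⟩
  have h2 : ∫ y, f y ∂(Measure.map L μ) = ∫ x, f (L x) ∂μ :=
    integral_map_equiv L.toHomeomorph.toMeasurableEquiv f
  rw [← h2]
  conv_lhs => rw [h]
  rw [integral_smul_nnreal_measure]
  rfl

/-- The linear map `z ↦ (a • x, b • p)` for `z = (x, p)`. -/
noncomputable def phaseScale (n : ℕ) {a b : ℝ} (ha : a ≠ 0) (hb : b ≠ 0) :
    PhaseSpace n ≃L[ℝ] Config n × Config n :=
  (WithLp.prodContinuousLinearEquiv 2 ℝ (Config n) (Config n)).trans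
    ((ContinuousLinearEquiv.smulLeft (Units.mk0 a ha)).prodCongr
      (ContinuousLinearEquiv.smulLeft (Units.mk0 b hb)))

theorem phaseScale_apply {n : ℕ} {a b : ℝ} (ha : a ≠ 0) (hb : b ≠ 0) (z : PhaseSpace n) :
    phaseScale n ha hb z = (a • z.fst, b • z.snd) := rfl

/-- The reflection of a Schwartz function. -/
noncomputable def schwartzReflect {V : Type*} [NormedAddCommGroup V] [NormedSpace ℝ V]
    (f : 𝓢(V, ℂ)) : 𝓢(V, ℂ) :=
  compCLMOfContinuousLinearEquiv ℂ (ContinuousLinearEquiv.neg ℝ) f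

@[simp]
theorem schwartzReflect_apply {V : Type*} [NormedAddCommGroup V] [NormedSpace ℝ V]
    (f : 𝓢(V, ℂ)) (x : V) : schwartzReflect f x = f (-x) := rfl

theorem schwartzReflect_ne_zero {V : Type*} [NormedAddCommGroup V] [NormedSpace ℝ V]
    {f : 𝓢(V, ℂ)} (hf : f ≠ 0) : schwartzReflect f ≠ 0 := fun h => hf <| by
  ext x
  have := DFunLike.congr_fun h (-x)
  simpa using this

/-- The linear change of variables `(x, τ) ↦ (x - τ, -x - τ)`. -/
noncomputable def wignerEquiv (V : Type*) [NormedAddCommGroup V] [NormedSpace ℝ V] :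
    (V × V) ≃L[ℝ] (V × V) :=
  ContinuousLinearEquiv.equivOfInverse
    ((ContinuousLinearMap.fst ℝ V V - ContinuousLinearMap.snd ℝ V V).prod
      (-ContinuousLinearMap.fst ℝ V V - ContinuousLinearMap.snd ℝ V V))
    (((1 / 2 : ℝ) • (ContinuousLinearMap.fst ℝ V V - ContinuousLinearMap.snd ℝ V V)).prod
      ((-(1 / 2) : ℝ) • (ContinuousLinearMap.fst ℝ V V + ContinuousLinearMap.snd ℝ V V)))
    (fun z => by ext <;> simp <;> module) (fun z => by ext <;> simp <;> module)

/-- The character `exp (-(2i/ħ) σ(z, z'))`. -/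
noncomputable def sympChar {n : ℕ} (ħ : ℝ) (z z' : PhaseSpace n) : ℂ :=
  cexp (((-(2 / ħ * symplecticForm z z') : ℝ) : ℂ) * I)

theorem norm_sympChar {n : ℕ} (ħ : ℝ) (z z' : PhaseSpace n) : ‖sympChar ħ z z'‖ = 1 :=
  norm_exp_ofReal_mul_I _

theorem Continuous.sympChar {n : ℕ} {X : Type*} [TopologicalSpace X] {ħ : ℝ}
    {f g : X → PhaseSpace n} (hf : Continuous f) (hg : Continuous g) :
    Continuous fun x => sympChar ħ (f x) (g x) := by
  have h1 : Continuous fun z : PhaseSpace n => z.fst := (WithLp.fstL 2 ℝ (Config n) (Config n)).continuous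
  have h2 : Continuous fun z : PhaseSpace n => z.snd := (WithLp.sndL 2 ℝ (Config n) (Config n)).continuous
  have := h1.comp hf
  have := h1.comp hg
  have := h2.comp hf
  have := h2.comp hg
  simp only [Function.comp_def] at *
  unfold _root_.sympChar symplecticForm
  fun_prop

section Reproducing

variable {n : ℕ} {ħ : ℝ}

theorem wavePacketWindow_apply (ħ : ℝ) (φ : 𝓢(Config n, ℂ)) (z : PhaseSpace n) (t : Config n) :
    wavePacketWindow ħ φ z t
      = 2 ^ n * (cexp (((-(2 / ħ * ⟪z.snd, t - z.fst⟫) : ℝ) : ℂ) * I)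
      * conj (φ ((2 : ℝ) • z.fst - t))) := rfl

theorem inv_pi_mul_ne_zero (hħ : 0 < ħ) : (Real.pi * ħ)⁻¹ ≠ 0 :=
  inv_ne_zero (mul_pos Real.pi_pos hħ).ne'

/-- The phase-space coordinates in which a wave-packet transform is a short-time Fourier
transform. -/
noncomputable def wavePacketScale (n : ℕ) (hħ : 0 < ħ) : PhaseSpace n ≃L[ℝ] Config n × Config n :=
  phaseScale n two_ne_zero (inv_pi_mul_ne_zero hħ)

/-- The factor `conj (φ (2x - t))` is a reflected window centred at `2x`, and `(2/ħ) p·t = 2π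
(p/(πħ))·t` gives the frequency. -/
theorem wavePacketWindow_eq_smul_stftWindow (hħ : 0 < ħ) (φ : 𝓢(Config n, ℂ))
    (z : PhaseSpace n) :
    wavePacketWindow ħ φ z = (2 ^ n * cexp (((2 / ħ * ⟪z.snd, z.fst⟫ : ℝ) : ℂ) * I)) •
      stftWindow (schwartzReflect φ) (wavePacketScale n hħ z).1 (wavePacketScale n hħ z).2 := by
  ext1 t
  rw [wavePacketWindow_apply, smul_apply, stftWindow_apply, wavePacketScale, phaseScale_apply,
    schwartzReflect_apply, neg_sub, smul_eq_mul]
  have h1 : cexp (((-(2 / ħ * ⟪z.snd, t - z.fst⟫) : ℝ) : ℂ) * I)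
      = cexp (((2 / ħ * ⟪z.snd, z.fst⟫ : ℝ) : ℂ) * I)
        * cexp (((-(2 * Real.pi * ⟪(Real.pi * ħ)⁻¹ • z.snd, t⟫) : ℝ) : ℂ) * I) := by
    rw [← Complex.exp_add, ← add_mul, ← Complex.ofReal_add]
    congr 3
    rw [inner_smul_left, inner_sub_right]
    have := hħ.ne'
    have := Real.pi_ne_zero
    simp only [conj_trivial]
    field_simp
    ring
  rw [h1]
  ring

theorem wavePacket_eq_stft (hħ : 0 < ħ) (φ : 𝓢(Config n, ℂ)) (ψ : 𝓢'(Config n, ℂ))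
    (z : PhaseSpace n) :
    wavePacket ħ φ ψ z = (((1 / (2 * Real.pi * ħ)) ^ ((n : ℝ) / 2) : ℝ) : ℂ) *
      (2 ^ n * cexp (((2 / ħ * ⟪z.snd, z.fst⟫ : ℝ) : ℂ) * I)) *
      stft (schwartzReflect φ) ψ (wavePacketScale n hħ z).1 (wavePacketScale n hħ z).2 := by
  rw [wavePacket, wavePacketWindow_eq_smul_stftWindow hħ, map_smul, smul_eq_mul, stft]
  exact (mul_assoc _ _ _).symm

theorem continuous_wavePacket (hħ : 0 < ħ) (φ : 𝓢(Config n, ℂ)) (ψ : 𝓢'(Config n, ℂ)) :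
    Continuous (wavePacket ħ φ ψ) := by
  rw [show wavePacket ħ φ ψ = _ from funext (wavePacket_eq_stft hħ φ ψ)]
  have h1 : Continuous fun z : PhaseSpace n => z.fst := (WithLp.fstL 2 ℝ (Config n) (Config n)).continuous
  have h2 : Continuous fun z : PhaseSpace n => z.snd := (WithLp.sndL 2 ℝ (Config n) (Config n)).continuous
  have h3 := (continuous_stft (schwartzReflect φ) ψ).comp (wavePacketScale n hħ).continuous
  simp only [Function.comp_def] at h3
  fun_prop

/-- A multiple of the symplectic Fourier transform of the Wigner function of `φ`. -/
noncomputable def ambiguity (hħ : 0 < ħ) (φ : 𝓢(Config n, ℂ)) : 𝓢(PhaseSpace n, ℂ) :=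
  compCLMOfContinuousLinearEquiv ℂ (phaseScale n one_ne_zero (inv_pi_mul_ne_zero hħ))
    (partialFourierSchwartz (compCLMOfContinuousLinearEquiv ℂ (wignerEquiv (Config n))
      (tensor (schwartzConj φ) φ)))

theorem ambiguity_apply (hħ : 0 < ħ) (φ : 𝓢(Config n, ℂ)) (z : PhaseSpace n) :
    ambiguity hħ φ z = ∫ τ : Config n, cexp (((-(2 / ħ * ⟪z.snd, τ⟫) : ℝ) : ℂ) * I)
      * (conj (φ (z.fst - τ)) * φ (-z.fst - τ)) := by
  change partialFourierSchwartz _ (phaseScale n one_ne_zero (inv_pi_mul_ne_zero hħ) z) = _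
  rw [partialFourierSchwartz_apply, phaseScale_apply, one_smul]
  congr 1
  funext τ
  have h : -2 * Real.pi * ⟪τ, (Real.pi * ħ)⁻¹ • z.snd⟫ = -(2 / ħ * ⟪z.snd, τ⟫) := by
    rw [inner_smul_right, real_inner_comm]
    have := hħ.ne'
    have := Real.pi_ne_zero
    field_simp
  rw [h]
  rfl

/-- Shifting the integration variable by `x + x'` symmetrises the two windows, which then depend on
`z - z'` alone; the phases combine to the symplectic character. The prefactor is the one in
`wavePacket_eq_stft`, so it turns the transform in the inversion formula back into a wave-packet
transform. -/
theorem overlap_wavePacketWindow (hħ : 0 < ħ) (φ : 𝓢(Config n, ℂ)) (z z' : PhaseSpace n) :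
    overlap (wavePacketWindow ħ φ z) (schwartzReflect φ) (wavePacketScale n hħ z')
      = (2 ^ n * cexp (((2 / ħ * ⟪z'.snd, z'.fst⟫ : ℝ) : ℂ) * I)) *
        (sympChar ħ z z' * ambiguity hħ φ (z - z')) := by
  rw [show wavePacketScale n hħ z'
    = ((wavePacketScale n hħ z').1, (wavePacketScale n hħ z').2) from rfl, overlap_apply,
    ← integral_add_right_eq_self (μ := (volume : Measure (Config n))) _ (z.fst + z'.fst),
    ambiguity_apply, ← integral_const_mul, ← integral_const_mul]
  congr 1
  funext τ
  rw [wavePacketWindow_apply, stftWindow_apply, wavePacketScale, phaseScale_apply,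
    schwartzReflect_apply, map_mul, Complex.conj_conj, ← Complex.exp_conj, map_mul,
    Complex.conj_ofReal, Complex.conj_I, sympChar]
  have e1 : (2 : ℝ) • z.fst - (τ + (z.fst + z'.fst)) = (z - z').fst - τ := by
    rw [WithLp.sub_fst]; module
  have e2 : -(τ + (z.fst + z'.fst) - (2 : ℝ) • z'.fst) = -(z - z').fst - τ := by
    rw [WithLp.sub_fst]; module
  simp only [e1, e2]
  have h1 : cexp (((-(2 / ħ * ⟪z.snd, τ + (z.fst + z'.fst) - z.fst⟫) : ℝ) : ℂ) * I)
      * cexp (((-(2 * Real.pi * ⟪(Real.pi * ħ)⁻¹ • z'.snd, τ + (z.fst + z'.fst)⟫) : ℝ) : ℂ) * -I)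
      = cexp (((2 / ħ * ⟪z'.snd, z'.fst⟫ : ℝ) : ℂ) * I)
      * cexp (((-(2 / ħ * symplecticForm z z') : ℝ) : ℂ) * I)
      * cexp (((-(2 / ħ * ⟪(z - z').snd, τ⟫) : ℝ) : ℂ) * I) := by
    rw [← Complex.exp_add, ← Complex.exp_add, ← Complex.exp_add]
    congr 1
    have hr : -(2 / ħ * ⟪z.snd, τ + (z.fst + z'.fst) - z.fst⟫)
        + 2 * Real.pi * ⟪(Real.pi * ħ)⁻¹ • z'.snd, τ + (z.fst + z'.fst)⟫
        = 2 / ħ * ⟪z'.snd, z'.fst⟫ + -(2 / ħ * symplecticForm z z')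
          + -(2 / ħ * ⟪(z - z').snd, τ⟫) := by
      have := hħ.ne'
      have := Real.pi_ne_zero
      simp only [symplecticForm, inner_smul_left, inner_sub_right, inner_add_right,
        inner_sub_left, WithLp.sub_snd, conj_trivial]
      field_simp
      ring
    have hc := congrArg (fun r : ℝ => (r : ℂ)) hr
    push_cast at hc ⊢
    linear_combination hc * I
  linear_combination (2 ^ n * conj (φ ((z - z').fst - τ)) * φ (-(z - z').fst - τ)) * h1

/-- Every wave-packet transform reproduces itself under a twisted convolution with a Schwartz
function that depends only on the window. -/
theorem exists_reproducing (hħ : 0 < ħ) {φ : 𝓢(Config n, ℂ)} (hφ : φ ≠ 0)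
    (ψ : 𝓢'(Config n, ℂ)) :
    ∃ κ : 𝓢(PhaseSpace n, ℂ), ∀ z, wavePacket ħ φ ψ z
      = ∫ z', wavePacket ħ φ ψ z' * (sympChar ħ z z' * κ (z - z')) := by
  obtain ⟨c, hc⟩ := exists_integral_eq_smul_integral_comp (wavePacketScale n hħ)
    (volume : Measure (PhaseSpace n)) ((volume : Measure (Config n)).prod volume)
  set J := ∫ y, schwartzReflect φ y * conj (schwartzReflect φ y) with hJ
  have hJ0 : J ≠ 0 := integral_mul_conj_self_ne_zero (schwartzReflect_ne_zero hφ)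
  -- Here `J` is the squared `L²` norm of the window, from the inversion formula, and `c` comes from
  -- the change to phase-space coordinates.
  refine ⟨(J⁻¹ * c) • ambiguity hħ φ, fun z => ?_⟩
  have h := (stft_inversion (schwartzReflect φ) (schwartzReflect φ) (wavePacketWindow ħ φ z) ψ).2
  rw [hc, ← hJ] at h
  have h1 : wavePacket ħ φ ψ z = J⁻¹ * c * ((((1 / (2 * Real.pi * ħ)) ^ ((n : ℝ) / 2) : ℝ) : ℂ) *
      ∫ z', overlap (wavePacketWindow ħ φ z) (schwartzReflect φ) (wavePacketScale n hħ z') *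
        stft (schwartzReflect φ) ψ (wavePacketScale n hħ z').1 (wavePacketScale n hħ z').2) := by
    rw [wavePacket]
    field_simp
    linear_combination (((1 / (2 * Real.pi * ħ)) ^ ((n : ℝ) / 2) : ℝ) : ℂ) * h
  rw [h1, ← integral_const_mul, ← integral_const_mul]
  congr 1
  funext z'
  rw [overlap_wavePacketWindow, wavePacket_eq_stft hħ φ ψ z', smul_apply, smul_eq_mul]
  ring

end Reproducing

end WavePacket

/-! ### The Moyal product on the phase-space side -/

section Moyal

open SchwartzMap

variable {n : ℕ} {ħ : ℝ}

/-- Bilinearity with `σ(z, z) = 0`. The Moyal phase is therefore affine in `z`, and integrating it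
against a Schwartz function is a symplectic Fourier transform. -/
theorem symplecticForm_sub_sub (z w w' : PhaseSpace n) :
    symplecticForm (z - w) (z - w') = symplecticForm z (w - w') + symplecticForm w w' := by
  simp only [symplecticForm, inner_sub_left, inner_sub_right, WithLp.sub_fst, WithLp.sub_snd]
  ring

theorem sympChar_mul (a b c d : PhaseSpace n) : sympChar ħ a b * sympChar ħ c d
    = cexp (((-(2 / ħ * (symplecticForm a b + symplecticForm c d)) : ℝ) : ℂ) * I) := by
  rw [sympChar, sympChar, ← Complex.exp_add]
  congr 1
  push_cast
  ring

theorem two_pi_mul_inner_rotEquiv (hħ : 0 < ħ) (z w : PhaseSpace n) :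
    2 * Real.pi * ⟪rotEquiv n hħ w, z⟫ = 2 / ħ * symplecticForm z w := by
  rw [rotEquiv_apply, WithLp.prod_inner_apply]
  change 2 * Real.pi * (⟪-(Real.pi * ħ)⁻¹ • w.snd, z.fst⟫ + ⟪(Real.pi * ħ)⁻¹ • w.fst, z.snd⟫) = _
  rw [inner_smul_left, inner_smul_left, symplecticForm, real_inner_comm z.snd w.fst]
  have := hħ.ne'
  have := Real.pi_ne_zero
  simp only [conj_trivial]
  field_simp
  ring

theorem stftWindow_rotEquiv_apply (hħ : 0 < ħ) (Φ : 𝓢(PhaseSpace n, ℂ)) (x w y : PhaseSpace n) :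
    stftWindow Φ x (rotEquiv n hħ w) y = sympChar ħ y w * conj (Φ (y - x)) := by
  rw [stftWindow_apply, two_pi_mul_inner_rotEquiv, sympChar]

/-- The symplectic Fourier transform `η ↦ ∫ exp (-(2i/ħ) σ(z, η)) Θ(z) dz`. -/
noncomputable def symplecticFourier (hħ : 0 < ħ) (Θ : 𝓢(PhaseSpace n, ℂ)) :
    𝓢(PhaseSpace n, ℂ) :=
  compCLMOfContinuousLinearEquiv ℂ (rotEquiv n hħ) (𝓕 Θ)

theorem symplecticFourier_apply (hħ : 0 < ħ) (Θ : 𝓢(PhaseSpace n, ℂ)) (η : PhaseSpace n) :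
    symplecticFourier hħ Θ η = ∫ z, sympChar ħ z η * Θ z := by
  change 𝓕 Θ (rotEquiv n hħ η) = _
  rw [fourier_coe, Real.fourier_eq']
  congr 1
  funext z
  rw [smul_eq_mul, sympChar, ← two_pi_mul_inner_rotEquiv hħ, real_inner_comm,
    show -2 * Real.pi * ⟪rotEquiv n hħ η, z⟫ = -(2 * Real.pi * ⟪rotEquiv n hħ η, z⟫) by ring]

theorem moyalTest_apply (hħ : 0 < ħ) (Θ : 𝓢(PhaseSpace n, ℂ)) (z'' z' : PhaseSpace n) :
    moyalTest hħ Θ z'' z' = ∫ z, sympChar ħ (z - z') (z - z'') * Θ z := rfl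

/-- Places `Θ ⋆ A` on the graph of `rotEquiv`: it is, up to a constant, a short-time Fourier
transform of `A` at position `w` and frequency `rotEquiv n hħ w`. -/
theorem moyalTest_eq_stftWindow (hħ : 0 < ħ) (Θ : 𝓢(PhaseSpace n, ℂ)) (w : PhaseSpace n) :
    moyalTest hħ Θ w
      = stftWindow (schwartzConj (symplecticFourier hħ Θ)) w (rotEquiv n hħ w) := by
  ext1 y
  rw [moyalTest_apply, stftWindow_rotEquiv_apply, schwartzConj_apply, Complex.conj_conj,
    symplecticFourier_apply, ← integral_const_mul]
  congr 1
  funext z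
  rw [← mul_assoc, sympChar_mul, sympChar, symplecticForm_sub_sub, add_comm]

theorem polyBounded_norm_clm {X Y : Type*} [NormedAddCommGroup X] [NormedSpace ℝ X]
    [NormedAddCommGroup Y] [NormedSpace ℝ Y] (L : X →L[ℝ] Y) : PolyBounded fun x => ‖L x‖ :=
  ((PolyBounded.const ‖L‖).mul PolyBounded.norm fun x => norm_nonneg x).mono fun x =>
    L.le_opNorm x

theorem polyBounded_norm_prodMk {X Y Z : Type*} [NormedAddCommGroup X]
    [NormedAddCommGroup Y] [NormedAddCommGroup Z] {f : X → Y} {g : X → Z}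
    (hf : PolyBounded fun x => ‖f x‖) (hg : PolyBounded fun x => ‖g x‖) :
    PolyBounded fun x => ‖(f x, g x)‖ :=
  (hf.add hg).mono fun _ => max_le (le_add_of_nonneg_right (norm_nonneg _))
    (le_add_of_nonneg_left (norm_nonneg _))

theorem polyBounded_norm_add {X Y : Type*} [NormedAddCommGroup X] [NormedAddCommGroup Y]
    {f g : X → Y} (hf : PolyBounded fun x => ‖f x‖) (hg : PolyBounded fun x => ‖g x‖) :
    PolyBounded fun x => ‖f x + g x‖ :=
  (hf.add hg).mono fun _ => norm_add_le _ _

theorem temperateFamily_moyalTest (hħ : 0 < ħ) (Θ : 𝓢(PhaseSpace n, ℂ)) :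
    TemperateFamily fun w => moyalTest hħ Θ w := by
  simp only [moyalTest_eq_stftWindow]
  exact (temperateFamily_stftWindow (schwartzConj (symplecticFourier hħ Θ))).comp
    (m := fun w => (w, rotEquiv n hħ w)) (by fun_prop)
    (polyBounded_norm_prodMk PolyBounded.norm
      (polyBounded_norm_clm (rotEquiv n hħ : PhaseSpace n →L[ℝ] PhaseSpace n)))

/-- The window through which a symbol is seen by a twisted convolution operator with kernel `κ`. -/
noncomputable def moyalWindow (hħ : 0 < ħ) (κ : 𝓢(PhaseSpace n, ℂ)) : 𝓢(PhaseSpace n, ℂ) :=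
  schwartzConj (schwartzReflect (symplecticFourier hħ κ))

/-- The twisted kernel `(w, z') ↦ (A ⋆ k_{z'})(w)` for `k_{z'}(z) = exp (-(2i/ħ) σ(z, z')) κ(z - z')`,
up to the constant of the Moyal product. -/
noncomputable def moyalKernel (hħ : 0 < ħ) (A : 𝓢'(PhaseSpace n, ℂ)) (κ : 𝓢(PhaseSpace n, ℂ))
    (w z' : PhaseSpace n) : ℂ :=
  sympChar ħ z' w * stft (moyalWindow hħ κ) A (w + z') (rotEquiv n hħ (z' - w))

theorem continuous_moyalKernel (hħ : 0 < ħ) (A : 𝓢'(PhaseSpace n, ℂ))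
    (κ : 𝓢(PhaseSpace n, ℂ)) :
    Continuous fun q : PhaseSpace n × PhaseSpace n => moyalKernel hħ A κ q.1 q.2 := by
  have h := (continuous_stft (moyalWindow hħ κ) A).comp
    (by fun_prop : Continuous fun q : PhaseSpace n × PhaseSpace n =>
      (q.1 + q.2, rotEquiv n hħ (q.2 - q.1)))
  have h' : Continuous fun q : PhaseSpace n × PhaseSpace n => sympChar ħ q.2 q.1 :=
    Continuous.sympChar continuous_snd continuous_fst
  exact h'.mul h

/-- After `z = v + z'` the phase is affine in `v` with slope `w + z' - y`, so the integral is the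
symplectic Fourier transform of `κ` there. What is left is a character in `y` of frequency `z' - w`
and the constant phase `χ(z', w)`. -/
theorem stftWindow_moyalWindow_apply (hħ : 0 < ħ) (κ : 𝓢(PhaseSpace n, ℂ))
    (w z' y : PhaseSpace n) :
    sympChar ħ z' w * stftWindow (moyalWindow hħ κ) (w + z') (rotEquiv n hħ (z' - w)) y
      = ∫ z, sympChar ħ (w - y) (w - z) * (sympChar ħ z z' * κ (z - z')) := by
  rw [stftWindow_rotEquiv_apply, moyalWindow, schwartzConj_apply, Complex.conj_conj,
    schwartzReflect_apply, symplecticFourier_apply,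
    ← integral_add_right_eq_self (μ := (volume : Measure (PhaseSpace n)))
      (fun z => sympChar ħ (w - y) (w - z) * (sympChar ħ z z' * κ (z - z'))) z',
    ← integral_const_mul, ← integral_const_mul]
  congr 1
  funext v
  rw [add_sub_cancel_right, ← mul_assoc, ← mul_assoc, ← mul_assoc]
  congr 1
  rw [sympChar_mul, sympChar_mul, sympChar, ← Complex.exp_add]
  congr 1
  simp only [symplecticForm, inner_sub_left, inner_sub_right, inner_add_left, inner_add_right,
    inner_neg_right, WithLp.sub_fst, WithLp.sub_snd, WithLp.add_fst, WithLp.add_snd,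
    WithLp.neg_fst, WithLp.neg_snd, inner_neg_left]
  push_cast
  ring

theorem temperateFamily_moyalWindow (hħ : 0 < ħ) (κ : 𝓢(PhaseSpace n, ℂ)) (z' : PhaseSpace n) :
    TemperateFamily fun w : PhaseSpace n =>
      stftWindow (moyalWindow hħ κ) (w + z') (rotEquiv n hħ (z' - w)) := by
  refine (temperateFamily_stftWindow (moyalWindow hħ κ)).comp
    (m := fun w => (w + z', rotEquiv n hħ (z' - w))) (by fun_prop) ?_
  refine polyBounded_norm_prodMk (polyBounded_norm_add PolyBounded.norm (PolyBounded.const _)) ?_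
  exact (polyBounded_norm_clm (rotEquiv n hħ : PhaseSpace n →L[ℝ] PhaseSpace n)).comp
    (m := fun w => z' - w)
    (((PolyBounded.const ‖z'‖).add PolyBounded.norm).mono fun w => norm_sub_le _ _)

theorem rapidDecay_twisted (κ : 𝓢(PhaseSpace n, ℂ)) (z' : PhaseSpace n) :
    RapidDecay fun z => sympChar ħ z z' * κ (z - z') := by
  refine RapidDecay.mul_bounded (M := 1) ?_ (Continuous.sympChar continuous_id continuous_const)
    fun z => (norm_sympChar _ _ _).le
  refine (rapidDecay κ).comp (m := fun z => z - z') (by fun_prop) (C := 1 + ‖z'‖) fun z => ?_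
  have h : ‖z‖ ≤ ‖z - z'‖ + ‖z'‖ := by
    calc ‖z‖ = ‖(z - z') + z'‖ := by rw [sub_add_cancel]
      _ ≤ _ := norm_add_le _ _
  nlinarith [norm_nonneg (z - z'), norm_nonneg z']

/-- Testing the symbol against the two kernels of a twisted convolution gives the same result. -/
theorem integral_twisted_mul_moyalTest (hħ : 0 < ħ) (A : 𝓢'(PhaseSpace n, ℂ))
    (κ Θ : 𝓢(PhaseSpace n, ℂ)) (z' : PhaseSpace n) :
    ∫ z, (sympChar ħ z z' * κ (z - z')) * A (moyalTest hħ Θ z)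
      = ∫ w, Θ w * moyalKernel hħ A κ w z' := by
  -- Each side is `A` applied to one Schwartz function, `F₁` or `F₂`. Their equality is Fubini for
  -- scalar integrals at each point `y`, dominated by `|κ(z - z')| |Θ(w)|`.
  obtain ⟨F₁, hF₁, hu₁⟩ := exists_integral_smul (μ := (volume : Measure (PhaseSpace n)))
    (rapidDecay_twisted (ħ := ħ) κ z') (temperateFamily_moyalTest hħ Θ)
  obtain ⟨F₂, hF₂, hu₂⟩ := exists_integral_smul (μ := (volume : Measure (PhaseSpace n)))
    ((rapidDecay Θ).mul_bounded (M := 1)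
      (Continuous.sympChar (ħ := ħ) (continuous_const (y := z')) continuous_id)
      fun z => (norm_sympChar _ _ _).le) (temperateFamily_moyalWindow hħ κ z')
  have hF : F₁ = F₂ := by
    ext1 y
    rw [hF₁, hF₂]
    have h1 : ∀ z, sympChar ħ z z' * κ (z - z') * moyalTest hħ Θ z y
        = ∫ w, sympChar ħ z z' * κ (z - z') * (sympChar ħ (w - y) (w - z) * Θ w) := fun z => by
      rw [moyalTest_apply, integral_const_mul]
    have h2 : ∀ w, sympChar ħ z' (id w) * Θ w *
          stftWindow (moyalWindow hħ κ) (w + z') (rotEquiv n hħ (z' - w)) y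
        = ∫ z, sympChar ħ z z' * κ (z - z') * (sympChar ħ (w - y) (w - z) * Θ w) := fun w => by
      rw [id, mul_right_comm, stftWindow_moyalWindow_apply, ← integral_mul_const]
      congr 1
      funext z
      ring
    simp only [h1, h2]
    refine integral_integral_swap ?_
    have hint : Integrable (fun q : PhaseSpace n × PhaseSpace n =>
        (sympChar ħ q.1 z' * κ (q.1 - z')) * Θ q.2) (volume.prod volume) :=
      ((rapidDecay_twisted (ħ := ħ) κ z').integrable).mul_prod Θ.integrable
    refine hint.mono (Continuous.aestronglyMeasurable ?_) (Filter.Eventually.of_forall fun q => ?_)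
    · have c1 : Continuous fun q : PhaseSpace n × PhaseSpace n => sympChar ħ q.1 z' :=
        Continuous.sympChar continuous_fst continuous_const
      have c2 : Continuous fun q : PhaseSpace n × PhaseSpace n =>
          sympChar ħ (q.2 - y) (q.2 - q.1) := Continuous.sympChar (by fun_prop) (by fun_prop)
      have c3 : Continuous fun q : PhaseSpace n × PhaseSpace n => κ (q.1 - z') :=
        κ.continuous.comp (by fun_prop)
      have c4 : Continuous fun q : PhaseSpace n × PhaseSpace n => Θ q.2 :=
        Θ.continuous.comp (by fun_prop)
      exact (c1.mul c3).mul (c2.mul c4)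
    · simp only [Function.uncurry, norm_mul, norm_sympChar, one_mul, le_refl]
  rw [← (hu₁ A).2, hF, (hu₂ A).2]
  congr 1
  funext w
  rw [moyalKernel, stft, id]
  ring

end Moyal

/-! ### Young's inequality for a kernel dominated by a convolution -/

section Young

variable {V : Type*} [NormedAddCommGroup V] [MeasurableSpace V] [BorelSpace V]
  [SecondCountableTopology V] {μ : Measure V} [SFinite μ] [μ.IsAddLeftInvariant]
  [μ.IsNegInvariant]

/-- Jensen's inequality for the measure with density `k`, whose total mass gives the last factor. -/
theorem lintegral_mul_rpow_le {α : Type*} [MeasurableSpace α] {μ : Measure α} {f k : α → ℝ≥0∞}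
    (hf : Measurable f) (hk : Measurable k) {r : ℝ} (hr : 1 ≤ r) :
    (∫⁻ z, f z * k z ∂μ) ^ r ≤ (∫⁻ z, f z ^ r * k z ∂μ) * (∫⁻ z, k z ∂μ) ^ (r - 1) := by
  have hr0 : 0 < r := by linarith
  have h := eLpNorm_le_eLpNorm_mul_rpow_measure_univ (μ := μ.withDensity k) (f := f)
    (p := 1) (q := ENNReal.ofReal r) (by simpa using hr) hf.aestronglyMeasurable
  rw [eLpNorm_one_eq_lintegral_enorm, eLpNorm_eq_lintegral_rpow_enorm_toReal
    (by simpa using hr0) ENNReal.ofReal_ne_top, ENNReal.toReal_ofReal hr0.le,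
    withDensity_apply _ MeasurableSet.univ, Measure.restrict_univ] at h
  simp only [enorm_eq_self] at h
  rw [lintegral_withDensity_eq_lintegral_mul _ hk hf,
    lintegral_withDensity_eq_lintegral_mul _ hk (hf.pow_const r)] at h
  simp only [Pi.mul_apply, ENNReal.toReal_one, div_one] at h
  simp only [mul_comm (k _)] at h
  calc (∫⁻ z, f z * k z ∂μ) ^ r
      ≤ ((∫⁻ z, f z ^ r * k z ∂μ) ^ (1 / r) * (∫⁻ z, k z ∂μ) ^ (1 - 1 / r)) ^ r :=
        ENNReal.rpow_le_rpow h hr0.le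
    _ = _ := by
      rw [ENNReal.mul_rpow_of_nonneg _ _ hr0.le, ← ENNReal.rpow_mul, ← ENNReal.rpow_mul,
        one_div_mul_cancel hr0.ne', ENNReal.rpow_one]
      congr 2
      field_simp

theorem lintegral_comp_sub_left (k : V → ℝ≥0∞) (w : V) :
    ∫⁻ z, k (w - z) ∂μ = ∫⁻ z, k z ∂μ :=
  lintegral_sub_left_eq_self k w

/-- Young's inequality for functions dominated by a convolution with an integrable function. -/
theorem eLpNorm_le_of_enorm_le_convolution {E : Type*} [NormedAddCommGroup E] {q : ℝ≥0∞}
    (hq : 1 ≤ q) {f k : V → ℝ≥0∞} (hf : Measurable f) (hk : Measurable k) {F : V → E}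
    (hF : ∀ w, ‖F w‖ₑ ≤ ∫⁻ z, f z * k (w - z) ∂μ) :
    eLpNorm F q μ ≤ eLpNorm f q μ * ∫⁻ z, k z ∂μ := by
  have hq0 : q ≠ 0 := (zero_lt_one.trans_le hq).ne'
  have hkw : ∀ w, Measurable fun z => k (w - z) := fun w => by fun_prop
  rcases eq_or_ne q ∞ with rfl | hqt
  · rw [eLpNorm_exponent_top, eLpNorm_exponent_top]
    refine eLpNormEssSup_le_of_ae_enorm_bound (Filter.Eventually.of_forall fun w => ?_)
    calc ‖F w‖ₑ ≤ ∫⁻ z, f z * k (w - z) ∂μ := hF w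
      _ ≤ ∫⁻ z, eLpNormEssSup f μ * k (w - z) ∂μ := by
        refine lintegral_mono_ae ?_
        filter_upwards [enorm_ae_le_eLpNormEssSup f μ] with z hz
        rw [enorm_eq_self] at hz
        gcongr
      _ = _ := by rw [lintegral_const_mul _ (hkw w), lintegral_comp_sub_left]
  · set r := q.toReal with hr
    have hr1 : 1 ≤ r := by
      rw [hr, ← ENNReal.toReal_one]
      exact ENNReal.toReal_mono hqt hq
    have hr0 : 0 < r := by linarith
    rw [eLpNorm_eq_lintegral_rpow_enorm_toReal hq0 hqt,
      eLpNorm_eq_lintegral_rpow_enorm_toReal hq0 hqt, ← hr]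
    simp only [enorm_eq_self]
    -- After Jensen and Tonelli, the factor `(∫ k)^(r - 1)` meets a further `∫ k`; the `r`-th root
    -- then leaves one power.
    have h1 : ∫⁻ w, ‖F w‖ₑ ^ r ∂μ ≤ (∫⁻ z, f z ^ r ∂μ) * (∫⁻ z, k z ∂μ) ^ r := by
      calc ∫⁻ w, ‖F w‖ₑ ^ r ∂μ
          ≤ ∫⁻ w, (∫⁻ z, f z ^ r * k (w - z) ∂μ) * (∫⁻ z, k z ∂μ) ^ (r - 1) ∂μ := by
            refine lintegral_mono fun w => ?_
            refine (ENNReal.rpow_le_rpow (hF w) hr0.le).trans ?_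
            refine (lintegral_mul_rpow_le hf (hkw w) hr1).trans_eq ?_
            rw [lintegral_comp_sub_left]
        _ = (∫⁻ w, ∫⁻ z, f z ^ r * k (w - z) ∂μ ∂μ) * (∫⁻ z, k z ∂μ) ^ (r - 1) := by
            refine lintegral_mul_const _ ?_
            exact Measurable.lintegral_prod_right'
              (f := fun p : V × V => f p.2 ^ r * k (p.1 - p.2)) (by fun_prop)
        _ = (∫⁻ z, f z ^ r * ∫⁻ w, k w ∂μ ∂μ) * (∫⁻ z, k z ∂μ) ^ (r - 1) := by
            rw [lintegral_lintegral_swap (Measurable.aemeasurable (by fun_prop))]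
            congr 1
            refine lintegral_congr fun z => ?_
            rw [lintegral_const_mul _ (by fun_prop), lintegral_sub_right_eq_self]
        _ = (∫⁻ z, f z ^ r ∂μ) * (∫⁻ z, k z ∂μ) ^ r := by
            rw [lintegral_mul_const _ (by fun_prop), mul_assoc]
            congr 1
            nth_rewrite 1 [← ENNReal.rpow_one (∫⁻ z, k z ∂μ)]
            rw [← ENNReal.rpow_add_of_nonneg _ _ zero_le_one (by linarith)]
            congr 1
            ring
    refine (ENNReal.rpow_le_rpow h1 (by positivity)).trans_eq ?_
    rw [ENNReal.mul_rpow_of_nonneg _ _ (by positivity), ← ENNReal.rpow_mul,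
      mul_one_div_cancel hr0.ne', ENNReal.rpow_one]

/-- Integrability on a product of a function dominated by a convolution integrand. -/
theorem integrable_prod_of_enorm_le {F : V × V → ℂ} (hF : AEStronglyMeasurable F (μ.prod μ))
    {f k : V → ℝ≥0∞} (hf : Measurable f) (hk : Measurable k) (hf' : ∫⁻ x, f x ∂μ < ∞)
    (hk' : ∫⁻ x, k x ∂μ < ∞) (h : ∀ x y, ‖F (x, y)‖ₑ ≤ f x * k (y - x)) :
    Integrable F (μ.prod μ) := by
  refine ⟨hF, ?_⟩
  have h1 : ∫⁻ p, ‖F p‖ₑ ∂(μ.prod μ) ≤ ∫⁻ p : V × V, f p.1 * k (p.2 - p.1) ∂(μ.prod μ) :=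
    lintegral_mono fun p => h p.1 p.2
  refine lt_of_le_of_lt h1 ?_
  rw [lintegral_prod _ (Measurable.aemeasurable (by fun_prop))]
  have h2 : ∀ x, ∫⁻ y, f x * k (y - x) ∂μ = f x * ∫⁻ y, k y ∂μ := fun x => by
    rw [lintegral_const_mul _ (by fun_prop), lintegral_sub_right_eq_self]
  simp only [h2]
  rw [lintegral_mul_const _ hf]
  exact ENNReal.mul_lt_top hf' hk'

end Young

/-! ### Weighted integrals under linear changes of variables. -/

theorem lintegral_comp_equiv_lt_top {V : Type*} [NormedAddCommGroup V] [NormedSpace ℝ V]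
    [FiniteDimensional ℝ V] [MeasurableSpace V] [BorelSpace V] {μ : Measure V}
    [μ.IsAddHaarMeasure] (L : V ≃L[ℝ] V) {g : V → ℝ≥0∞} (hg : ∫⁻ x, g x ∂μ < ∞) :
    ∫⁻ x, g (L x) ∂μ < ∞ := by
  have : (Measure.map L μ).IsAddHaarMeasure := L.isAddHaarMeasure_map μ
  have h := Measure.isAddLeftInvariant_eq_smul (Measure.map L μ) μ
  have h2 : ∫⁻ y, g y ∂(Measure.map L μ) = ∫⁻ x, g (L x) ∂μ :=
    lintegral_map_equiv g L.toHomeomorph.toMeasurableEquiv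
  rw [← h2, h, lintegral_smul_measure]
  exact ENNReal.mul_lt_top ENNReal.coe_lt_top hg

theorem lintegral_polyWeight_mul_comp_equiv_lt_top {V : Type*} [NormedAddCommGroup V]
    [NormedSpace ℝ V] [FiniteDimensional ℝ V] [MeasurableSpace V] [BorelSpace V] {μ : Measure V}
    [μ.IsAddHaarMeasure] (L : V ≃L[ℝ] V) {s : ℝ} (hs : 0 ≤ s) {g : V → ℝ≥0∞}
    (hg : ∫⁻ x, polyWeight s x * g x ∂μ < ∞) : ∫⁻ x, polyWeight s x * g (L x) ∂μ < ∞ := by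
  -- The maximum with `1` is what makes `1 + |x|² ≤ M² (1 + |L x|²)` hold near the origin too.
  set M := max 1 ‖(L.symm : V →L[ℝ] V)‖
  have hL : ∀ x, ‖x‖ ≤ M * ‖L x‖ := fun x => by
    calc ‖x‖ = ‖(L.symm : V →L[ℝ] V) (L x)‖ := by simp
      _ ≤ ‖(L.symm : V →L[ℝ] V)‖ * ‖L x‖ := ContinuousLinearMap.le_opNorm _ _
      _ ≤ _ := by gcongr; exact le_max_right _ _
  refine lt_of_le_of_lt (lintegral_mono fun x => mul_le_mul_left
    (polyWeight_le_of_norm_le hs (le_max_left 1 _) (hL x)) _) ?_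
  simp only [mul_assoc]
  rw [lintegral_const_mul' _ _ ENNReal.ofReal_ne_top]
  exact ENNReal.mul_lt_top ENNReal.ofReal_lt_top (lintegral_comp_equiv_lt_top L hg)

theorem lintegral_le_lintegral_polyWeight_mul {V : Type*} [NormedAddCommGroup V]
    [MeasurableSpace V] {μ : Measure V} {s : ℝ} (hs : 0 ≤ s) (g : V → ℝ≥0∞) :
    ∫⁻ x, g x ∂μ ≤ ∫⁻ x, polyWeight s x * g x ∂μ :=
  lintegral_mono fun x => le_mul_of_one_le_left zero_le (one_le_polyWeight hs x)

/-! ### Existence and boundedness of the Moyal product -/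

section Main

open SchwartzMap

theorem isNegInvariant_of_isAddHaarMeasure {V : Type*} [NormedAddCommGroup V] [NormedSpace ℝ V]
    [FiniteDimensional ℝ V] [MeasurableSpace V] [BorelSpace V] (μ : Measure V)
    [μ.IsAddHaarMeasure] : μ.IsNegInvariant :=
  have := FiniteDimensional.proper_real V
  inferInstance

instance (n : ℕ) : (volume : Measure (PhaseSpace n)).IsNegInvariant :=
  isNegInvariant_of_isAddHaarMeasure volume

variable {n : ℕ} {ħ : ℝ}

theorem enorm_polyWeight_mul (s : ℝ) (z : PhaseSpace n) (c : ℂ) :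
    ‖(((1 + ‖z‖ ^ 2) ^ (s / 2) : ℝ) : ℂ) * c‖ₑ = polyWeight s z * ‖c‖ₑ := by
  rw [enorm_mul, polyWeight, ← ofReal_norm, Complex.norm_real,
    Real.norm_of_nonneg (by positivity)]

theorem MemWeightedLp.memLp {s : ℝ} (hs : 0 ≤ s) {q : ℝ≥0∞} {b : PhaseSpace n → ℂ}
    (hb : MemWeightedLp s q b) (hc : AEStronglyMeasurable b volume) : MemLp b q volume := by
  refine MemLp.mono hb hc (Filter.Eventually.of_forall fun z => ?_)
  rw [norm_mul, Complex.norm_real, Real.norm_of_nonneg (by positivity)]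
  exact le_mul_of_one_le_left (norm_nonneg _)
    (Real.one_le_rpow (by nlinarith [sq_nonneg ‖z‖]) (by positivity))

/-- A function that reproduces itself under a twisted convolution is bounded if it is in `L^q`. -/
theorem exists_bound_of_reproducing {q : ℝ≥0∞} (hq : 1 ≤ q) {b : PhaseSpace n → ℂ}
    (hb : MemLp b q volume) {κ : 𝓢(PhaseSpace n, ℂ)}
    (h : ∀ z, b z = ∫ z', b z' * (sympChar ħ z z' * κ (z - z'))) :
    ∃ M : ℝ≥0∞, M < ∞ ∧ ∀ z, ‖b z‖ₑ ≤ M := by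
  -- Hölder's inequality in `z'`. The norm of `κ (z - ·)` is independent of `z`, and Schwartz
  -- functions have every conjugate exponent, so the bound is uniform.
  have : q.HolderConjugate q.conjExponent := ENNReal.HolderConjugate.conjExponent hq
  refine ⟨eLpNorm b q volume * eLpNorm κ q.conjExponent volume,
    ENNReal.mul_lt_top hb.2 (κ.memLp q.conjExponent volume).2, fun z => ?_⟩
  have hmp : MeasurePreserving (fun z' : PhaseSpace n => z - z') volume volume :=
    Measure.measurePreserving_sub_left volume z
  have hκ : AEStronglyMeasurable (κ : PhaseSpace n → ℂ) volume := κ.continuous.aestronglyMeasurable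
  have hκz : AEStronglyMeasurable (fun z' => κ (z - z')) volume :=
    (κ.continuous.comp (by fun_prop)).aestronglyMeasurable
  have h1 := eLpNorm_smul_le_mul_eLpNorm (p := q) (q := q.conjExponent) (r := 1) hκz hb.1
  have h2 : eLpNorm (fun z' => κ (z - z')) q.conjExponent volume
      = eLpNorm κ q.conjExponent volume := eLpNorm_comp_measurePreserving hκ hmp
  rw [h2, eLpNorm_one_eq_lintegral_enorm] at h1
  refine le_trans ?_ h1
  rw [h z]
  refine (enorm_integral_le_lintegral_enorm _).trans_eq (lintegral_congr fun z' => ?_)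
  rw [enorm_mul, enorm_mul, ← ofReal_norm (sympChar ħ z z'), norm_sympChar, ENNReal.ofReal_one,
    one_mul, Pi.smul_apply', smul_eq_mul, enorm_mul]

/-- On the graph of `rotEquiv` the frequency bound becomes an integrable function of position. This
lets `Θ ⋆ A` be paired with any bounded continuous function. -/
theorem MemSjostrand.integrable_moyalTest {s : ℝ} (hs : 0 ≤ s) {A : 𝓢'(PhaseSpace n, ℂ)}
    (hA : MemSjostrand s A) (hħ : 0 < ħ) (Θ : 𝓢(PhaseSpace n, ℂ)) :
    Integrable (fun z => A (moyalTest hħ Θ z)) volume := by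
  obtain ⟨h, -, hb, hi⟩ := hA.exists_bound_stft hs (schwartzConj (symplecticFourier hħ Θ))
  have hc : Continuous fun z => A (moyalTest hħ Θ z) :=
    (show 𝓢(PhaseSpace n, ℂ) →L[ℂ] ℂ from A).continuous.comp
      (temperateFamily_moyalTest hħ Θ).continuous
  refine ⟨hc.aestronglyMeasurable, lt_of_le_of_lt (lintegral_mono fun z => ?_)
    (lintegral_comp_equiv_lt_top (rotEquiv n hħ)
      (lt_of_le_of_lt (lintegral_le_lintegral_polyWeight_mul hs h) hi))⟩
  change ‖A (moyalTest hħ Θ z)‖ₑ ≤ _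
  rw [moyalTest_eq_stftWindow]
  exact hb z (rotEquiv n hħ z)

/-- The Moyal kernel of a symbol in a weighted Sjöstrand class is dominated by a convolution
kernel. -/
theorem MemSjostrand.exists_bound_moyalKernel {s : ℝ} (hs : 0 ≤ s) {A : 𝓢'(PhaseSpace n, ℂ)}
    (hA : MemSjostrand s A) (hħ : 0 < ħ) (κ : 𝓢(PhaseSpace n, ℂ)) :
    ∃ k : PhaseSpace n → ℝ≥0∞, Measurable k ∧
      (∀ w z', ‖moyalKernel hħ A κ w z'‖ₑ ≤ k (z' - w)) ∧
      ∫⁻ v, polyWeight s v * k v < ∞ := by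
  obtain ⟨h, hm, hb, hi⟩ := hA.exists_bound_stft hs (moyalWindow hħ κ)
  refine ⟨fun v => h (rotEquiv n hħ v), hm.comp (rotEquiv n hħ).continuous.measurable,
    fun w z' => ?_, lintegral_polyWeight_mul_comp_equiv_lt_top (rotEquiv n hħ) hs hi⟩
  rw [moyalKernel, enorm_mul, ← ofReal_norm (sympChar ħ z' w), norm_sympChar, ENNReal.ofReal_one,
    one_mul]
  exact hb _ _

/-- The Moyal product of a symbol with a function that reproduces itself under the twisted
convolution with `κ`. -/
noncomputable def moyalProd (hħ : 0 < ħ) (A : 𝓢'(PhaseSpace n, ℂ)) (κ : 𝓢(PhaseSpace n, ℂ))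
    (b : PhaseSpace n → ℂ) (w : PhaseSpace n) : ℂ :=
  (((1 / (Real.pi * ħ)) ^ (2 * n) : ℝ) : ℂ) * ∫ z', b z' * moyalKernel hħ A κ w z'

section

variable {s : ℝ} {A : 𝓢'(PhaseSpace n, ℂ)} {b : PhaseSpace n → ℂ} {κ : 𝓢(PhaseSpace n, ℂ)}
  {M : ℝ≥0∞}

/-- Justifies the first exchange of integrals: `Θ` is integrable in `w`, and the kernel is dominated
by an integrable function of `z' - w`. -/
theorem integrable_test_mul_moyalKernel (hs : 0 ≤ s) (hA : MemSjostrand s A) (hħ : 0 < ħ)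
    (hb : Continuous b) (hM : M < ∞) (hbM : ∀ z, ‖b z‖ₑ ≤ M) (κ Θ : 𝓢(PhaseSpace n, ℂ)) :
    Integrable (fun p : PhaseSpace n × PhaseSpace n =>
      Θ p.1 * (b p.2 * moyalKernel hħ A κ p.1 p.2)) (volume.prod volume) := by
  obtain ⟨k, hkm, hk, hki⟩ := hA.exists_bound_moyalKernel hs hħ κ
  refine integrable_prod_of_enorm_le ?_ (f := fun w => M * ‖Θ w‖ₑ)
    (Θ.continuous.enorm.measurable.const_mul M) hkm ?_
    (lt_of_le_of_lt (lintegral_le_lintegral_polyWeight_mul hs k) hki) fun w z' => ?_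
  · have c1 : Continuous fun p : PhaseSpace n × PhaseSpace n => Θ p.1 :=
      Θ.continuous.comp continuous_fst
    have c2 : Continuous fun p : PhaseSpace n × PhaseSpace n => b p.2 :=
      hb.comp continuous_snd
    exact (c1.mul (c2.mul (continuous_moyalKernel hħ A κ))).aestronglyMeasurable
  · rw [lintegral_const_mul' _ _ hM.ne]
    exact ENNReal.mul_lt_top hM Θ.integrable.2
  · rw [enorm_mul, enorm_mul]
    calc ‖Θ w‖ₑ * (‖b z'‖ₑ * ‖moyalKernel hħ A κ w z'‖ₑ) ≤ ‖Θ w‖ₑ * (M * k (z' - w)) := by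
          gcongr
          · exact hbM z'
          · exact hk w z'
      _ = M * ‖Θ w‖ₑ * k (z' - w) := by ring

/-- Justifies the second exchange: integrability in `z` now comes from the symbol, and in `z' - z`
from `κ`. -/
theorem integrable_reproducing_mul_moyalTest (hs : 0 ≤ s) (hA : MemSjostrand s A) (hħ : 0 < ħ)
    (hb : Continuous b) (hM : M < ∞) (hbM : ∀ z, ‖b z‖ₑ ≤ M) (κ Θ : 𝓢(PhaseSpace n, ℂ)) :
    Integrable (fun p : PhaseSpace n × PhaseSpace n =>
      b p.2 * (sympChar ħ p.1 p.2 * κ (p.1 - p.2)) * A (moyalTest hħ Θ p.1))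
      (volume.prod volume) := by
  have hint := hA.integrable_moyalTest hs hħ Θ
  have hc : Continuous fun z => A (moyalTest hħ Θ z) :=
    (show 𝓢(PhaseSpace n, ℂ) →L[ℂ] ℂ from A).continuous.comp
      (temperateFamily_moyalTest hħ Θ).continuous
  have hκ : Continuous fun v => κ (-v) := κ.continuous.comp continuous_neg
  refine integrable_prod_of_enorm_le ?_ (f := fun z => M * ‖A (moyalTest hħ Θ z)‖ₑ)
    (k := fun v => ‖κ (-v)‖ₑ) (hc.enorm.measurable.const_mul M) hκ.enorm.measurable ?_ ?_
    fun z z' => ?_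
  · have c1 : Continuous fun p : PhaseSpace n × PhaseSpace n => b p.2 :=
      hb.comp continuous_snd
    have c2 : Continuous fun p : PhaseSpace n × PhaseSpace n => κ (p.1 - p.2) :=
      κ.continuous.comp (by fun_prop)
    have c3 : Continuous fun p : PhaseSpace n × PhaseSpace n => A (moyalTest hħ Θ p.1) :=
      hc.comp continuous_fst
    exact ((c1.mul ((Continuous.sympChar continuous_fst continuous_snd).mul c2)).mul
      c3).aestronglyMeasurable
  · rw [lintegral_const_mul' _ _ hM.ne]
    exact ENNReal.mul_lt_top hM hint.2
  · exact (schwartzReflect κ).integrable.2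
  · rw [enorm_mul, enorm_mul, enorm_mul, ← ofReal_norm (sympChar ħ z z'), norm_sympChar,
      ENNReal.ofReal_one, one_mul, neg_sub]
    calc ‖b z'‖ₑ * ‖κ (z - z')‖ₑ * ‖A (moyalTest hħ Θ z)‖ₑ
        ≤ M * ‖κ (z - z')‖ₑ * ‖A (moyalTest hħ Θ z)‖ₑ := by gcongr; exact hbM z'
      _ = _ := by ring

/-- Fubini moves `Θ` onto the kernel, `integral_twisted_mul_moyalTest` moves the symbol onto `Θ`,
and a second Fubini exposes the reproducing integral, which collapses to `b`. -/
theorem isMoyalProduct_moyalProd (hs : 0 ≤ s) (hA : MemSjostrand s A) (hħ : 0 < ħ)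
    (hb : Continuous b) (hM : M < ∞) (hbM : ∀ z, ‖b z‖ₑ ≤ M)
    (h : ∀ z, b z = ∫ z', b z' * (sympChar ħ z z' * κ (z - z')))
    {B : PhaseSpace n → ℂ} (hB : B =ᵐ[volume] b) :
    IsMoyalProduct hħ A B (moyalProd hħ A κ b) := by
  have hae : ∀ Θ : 𝓢(PhaseSpace n, ℂ), (fun z => B z * schwartzMoyal hħ Θ A z) =ᵐ[volume]
      fun z => b z * schwartzMoyal hħ Θ A z := fun Θ => by
    filter_upwards [hB] with z hz
    rw [hz]
  have hprod : ∀ Θ : 𝓢(PhaseSpace n, ℂ), ∀ w, moyalProd hħ A κ b w * Θ w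
      = (((1 / (Real.pi * ħ)) ^ (2 * n) : ℝ) : ℂ)
        * ∫ z', Θ w * (b z' * moyalKernel hħ A κ w z') := fun Θ w => by
    rw [integral_const_mul, moyalProd]
    ring
  refine ⟨fun Θ => ?_, fun Θ => ?_, fun Θ => ?_⟩
  · rw [integrable_congr (hae Θ)]
    refine Integrable.bdd_mul ((hA.integrable_moyalTest hs hħ Θ).const_mul _)
      hb.aestronglyMeasurable (c := M.toReal) (Filter.Eventually.of_forall fun z => ?_)
    rw [← toReal_enorm]
    exact ENNReal.toReal_mono hM.ne (hbM z)
  · simp only [hprod]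
    exact (integrable_test_mul_moyalKernel hs hA hħ hb hM hbM κ Θ).integral_prod_left.const_mul _
  · rw [integral_congr_ae (hae Θ)]
    simp only [hprod]
    rw [integral_const_mul,
      integral_integral_swap (integrable_test_mul_moyalKernel hs hA hħ hb hM hbM κ Θ)]
    have h1 : ∀ z', ∫ w, Θ w * (b z' * moyalKernel hħ A κ w z')
        = ∫ z, b z' * (sympChar ħ z z' * κ (z - z')) * A (moyalTest hħ Θ z) := fun z' => by
      have := integral_twisted_mul_moyalTest hħ A κ Θ z'
      calc ∫ w, Θ w * (b z' * moyalKernel hħ A κ w z')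
          = ∫ w, b z' * (Θ w * moyalKernel hħ A κ w z') := by
            congr 1; funext w; ring
        _ = ∫ z, b z' * ((sympChar ħ z z' * κ (z - z')) * A (moyalTest hħ Θ z)) := by
            rw [integral_const_mul, integral_const_mul, this]
        _ = _ := by simp only [mul_assoc]
    simp only [h1]
    rw [← integral_integral_swap (integrable_reproducing_mul_moyalTest hs hA hħ hb hM hbM κ Θ),
      ← integral_const_mul]
    congr 1
    funext z
    rw [integral_mul_const, ← h z, schwartzMoyal]
    ring

theorem memWeightedLp_moyalProd (hs : 0 ≤ s) (hA : MemSjostrand s A) (hħ : 0 < ħ) {q : ℝ≥0∞}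
    (hq : 1 ≤ q) (hb : Continuous b) (hbq : MemWeightedLp s q b) (κ : 𝓢(PhaseSpace n, ℂ)) :
    MemWeightedLp s q (moyalProd hħ A κ b) := by
  obtain ⟨k, hkm, hk, hki⟩ := hA.exists_bound_moyalKernel hs hħ κ
  have hw : Measurable (polyWeight s : PhaseSpace n → ℝ≥0∞) :=
    (continuous_polyWeight s).measurable
  have hmeas : StronglyMeasurable fun w => ∫ z', b z' * moyalKernel hħ A κ w z' := by
    refine StronglyMeasurable.integral_prod_right
      (f := fun w z' => b z' * moyalKernel hħ A κ w z') (Continuous.stronglyMeasurable ?_)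
    exact (hb.comp continuous_snd).mul (continuous_moyalKernel hħ A κ)
  have hwc : Continuous fun z : PhaseSpace n => (((1 + ‖z‖ ^ 2) ^ (s / 2) : ℝ) : ℂ) :=
    Complex.continuous_ofReal.comp (continuous_rpow_one_add_norm_sq s)
  set c : ℂ := (((1 / (Real.pi * ħ)) ^ (2 * n) : ℝ) : ℂ) with hc
  set f : PhaseSpace n → ℝ≥0∞ := fun z => polyWeight s z * ‖b z‖ₑ with hf
  have hfm : Measurable f := hw.mul hb.enorm.measurable
  -- The kernel bound is a function of `z' - w`, while Young's inequality uses `w - z'`; hence the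
  -- sign. The constants are those of the Moyal product and of splitting the weight along `w = z' +
  -- (w - z')`.
  set k' : PhaseSpace n → ℝ≥0∞ := fun v =>
    (‖c‖ₑ * ENNReal.ofReal (2 ^ (s / 2))) * (polyWeight s (-v) * k (-v)) with hk'
  have hk'm : Measurable k' := by fun_prop
  have hk'i : ∫⁻ v, k' v < ∞ := by
    rw [hk', lintegral_const_mul' _ _ (by finiteness),
      lintegral_neg_eq_self (fun v => polyWeight s v * k v)]
    exact ENNReal.mul_lt_top (by finiteness) hki
  refine ⟨hwc.aestronglyMeasurable.mul (hmeas.aestronglyMeasurable.const_mul c), ?_⟩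
  refine lt_of_le_of_lt (eLpNorm_le_of_enorm_le_convolution hq hfm hk'm fun w => ?_)
    (ENNReal.mul_lt_top (lt_of_eq_of_lt (eLpNorm_congr_enorm_ae
      (Filter.Eventually.of_forall fun z => ?_)) hbq.2) hk'i)
  · rw [enorm_polyWeight_mul, moyalProd, enorm_mul]
    calc polyWeight s w * (‖c‖ₑ * ‖∫ z', b z' * moyalKernel hħ A κ w z'‖ₑ)
        ≤ polyWeight s w * (‖c‖ₑ * ∫⁻ z', ‖b z' * moyalKernel hħ A κ w z'‖ₑ) := by
          gcongr; exact enorm_integral_le_lintegral_enorm _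
      _ = ∫⁻ z', polyWeight s w * (‖c‖ₑ * ‖b z' * moyalKernel hħ A κ w z'‖ₑ) := by
          rw [lintegral_const_mul' _ _ (polyWeight_ne_top s w),
            lintegral_const_mul' _ _ (by finiteness)]
      _ ≤ ∫⁻ z', f z' * k' (w - z') := by
          refine lintegral_mono fun z' => ?_
          have h1 := polyWeight_add_le hs z' (w - z')
          rw [add_sub_cancel] at h1
          have h2 : polyWeight s (-(w - z')) = polyWeight s (w - z') := by
            simp only [polyWeight, norm_neg]
          simp only [hk', hf]
          rw [h2, neg_sub, enorm_mul]
          calc polyWeight s w * (‖c‖ₑ * (‖b z'‖ₑ * ‖moyalKernel hħ A κ w z'‖ₑ))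
              ≤ (ENNReal.ofReal (2 ^ (s / 2)) * (polyWeight s z' * polyWeight s (w - z')))
                * (‖c‖ₑ * (‖b z'‖ₑ * k (z' - w))) := by gcongr; exact hk w z'
            _ = _ := by ring
  · rw [enorm_polyWeight_mul, enorm_eq_self]

end

end Main

theorem mainTheorem4 (n : ℕ) (ħ : ℝ) (hħ : 0 < ħ) (s : ℝ) (hs : 0 ≤ s) (q : ℝ≥0∞) (hq : 1 ≤ q)
    (A : 𝓢'(PhaseSpace n, ℂ)) (hA : MemSjostrand s A)
    (B : PhaseSpace n → ℂ) (hB : IsAdmissible ħ s q B) :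
    ∃ C : PhaseSpace n → ℂ, IsMoyalProduct hħ A B C ∧ MemWeightedLp s q C := by
  obtain ⟨hBq, ψ, -, φ, hφ, hBψ⟩ := hB
  -- The continuous representative of `B` satisfies the reproducing formula at every point, hence is
  -- bounded everywhere.
  have hb := continuous_wavePacket hħ φ ψ
  have hbq : MemWeightedLp s q (wavePacket ħ φ ψ) := by
    refine (memLp_congr_ae ?_).1 hBq
    filter_upwards [hBψ] with z hz
    rw [hz]
  obtain ⟨κ, hκ⟩ := exists_reproducing hħ hφ ψ
  obtain ⟨M, hM, hbM⟩ := exists_bound_of_reproducing hq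
    (hbq.memLp hs hb.aestronglyMeasurable) hκ
  exact ⟨moyalProd hħ A κ (wavePacket ħ φ ψ),
    isMoyalProduct_moyalProd hs hA hħ hb hM hbM hκ hBψ,
    memWeightedLp_moyalProd hs hA hħ hq hb hbq κ⟩
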